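/- **Model.** Let $M\ge 2$, let $\mathcal A$ be a finite set of actions and $\mathcal X$ a measurable observation space with a reference measure $\mu$. For $i\in\{1,\dots,M\}$ and $a\in\mathcal A$ let $q_i^a$ be a probability density with respect to $\mu$. Under hypothesis $H_i$, given the action $A_n=a$, the observation $X_n$ has density $q_i^a$ and is conditionally independent of the past actions and observations; $E_i$ denotes expectation under $H_i$. Let $D(q_i^a\Vert q_j^a)$ be the relative entropy, $\mathcal P(\mathcal A)$ the set of probability distributions on $\mathcal A$, $$D_i=\max_{\lambda\in\mathcal P(\mathcal A)}\ \min_{j\ne i}\ \sum_{a\in\mathcal A}\lambda(a)\,D(q_i^a\Vert q_j^a),$$ and for each $i$ let $\lambda_i$ be an arbitrary (fixed) maximizer. Let $\mathcal A_{ij}=\{a: D(q_i^a\Vert q_j^a)>0\}$. Assume - (I) $E_i\big[\big(\log\frac{q_i^a(X)}{q_j^a(X)}\big)^2\big]<\infty$ for all $i,j,a$, where $X$ has density $q_i^a$; - (IIb) $\min_{i\ne j,\,k}\ \sum_{a\in\mathcal A_{ij}}\lambda_k(a)>0$. Let $g:\mathcal A\times\mathcal A\to[0,\infty)$ with $g(a,a)=0$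 for all $a$ be the switching cost and $g_{\max}=\max_{a,a'}g(a,a')$. **Sluggish Procedure A, $\pi_{SA}(L,\eta)$** ($L>0$, $0<\eta\le1$). The first action $A_1$ is drawn from an arbitrary distribution on $\mathcal A$, independently of everything else. At each time $n\ge1$, with $Z_i(n)=\sum_{l=1}^n\log q_i^{A_l}(X_l)$, let $\theta(n)\in\arg\max_i Z_i(n)$, ties being resolved uniformly at random. If $Z_{\theta(n)}(n)-Z_j(n)\ge\log((M-1)L)$ for all $j\ne\theta(n)$, stop and declare $H_{\theta(n)}$. Otherwise generate a Bernoulli($\eta$) variable $U_{n+1}$ independent of everything else; if $U_{n+1}=0$ put $A_{n+1}=A_n$, and if $U_{n+1}=1$ draw $A_{n+1}$ from $\lambda_{\theta(n)}$. Let $\tau$ be the time at which the procedure stops ($\tau=\infty$ if it never does), and let the total cost be $$C(\pi_{SA}(L,\eta))=\tau+\sum_{l=1}^{\tau-1}g(A_l,A_{l+1}).$$ **Proposition.** For every $i$ and every $0<\eta\le1$, $$\limsup_{L\to\infty}\ E_i\!\left[\frac{C(\pi_{SA}(L,\eta))}{\log L}\right]\ \le\ \frac1{D_i}+\frac{g_{\max}\,\eta}{D_i}.$$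 -/

import Mathlib

open MeasureTheory ProbabilityTheory Filter
open scoped NNReal ENNReal

noncomputable section

namespace ASHT

/-- The observation model of active sequential hypothesis testing with `M` hypotheses, action set
`A` and observation space `X`: under hypothesis `i` and action `a` the observation has the
probability density `q i a` with respect to the reference measure `μ`. -/
structure Model (M : ℕ) (A X : Type*) [MeasurableSpace X] where
  μ : Measure X
  q : Fin M → A → X → ℝ≥0
  measurable_q : ∀ i a, Measurable (q i a)
  lintegral_q : ∀ i a, ∫⁻ x, (q i a x : ℝ≥0∞) ∂μ = 1

variable {M : ℕ} {A X : Type*} [MeasurableSpace X]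

namespace Model

/-- The law of an observation under hypothesis `i` when action `a` is used. -/
def obsLaw (m : Model M A X) (i : Fin M) (a : A) : Measure X :=
  m.μ.withDensity (fun x => (m.q i a x : ℝ≥0∞))

instance (m : Model M A X) (i : Fin M) (a : A) : IsProbabilityMeasure (m.obsLaw i a) :=
  ⟨by rw [obsLaw, withDensity_apply _ MeasurableSet.univ, Measure.restrict_univ]
      exact m.lintegral_q i a⟩

/-- The relative entropy `D(q_i^a ‖ q_j^a)`. -/
def relEnt (m : Model M A X) (i j : Fin M) (a : A) : ℝ≥0∞ :=
  InformationTheory.klDiv (m.obsLaw i a) (m.obsLaw j a)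

/-- `min_{j ≠ i} ∑_a p(a) D(q_i^a ‖ q_j^a)` for a mixed action `p`. -/
def guard [Fintype A] (m : Model M A X) (i : Fin M) (p : PMF A) : ℝ≥0∞ :=
  ⨅ (j : Fin M) (_ : j ≠ i), ∑ a, p a * m.relEnt i j a

/-- `D_i = max_p min_{j ≠ i} ∑_a p(a) D(q_i^a ‖ q_j^a)`, over all mixed actions `p`. -/
def D [Fintype A] (m : Model M A X) (i : Fin M) : ℝ≥0∞ :=
  ⨆ p : PMF A, m.guard i p

/-- The set `A_ij` of the actions that differentiate hypothesis `i` from hypothesis `j`. -/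
def discriminating (m : Model M A X) (i j : Fin M) : Set A :=
  {a | 0 < m.relEnt i j a}

/-- Every log-likelihood ratio has a finite second moment:
`E_i[(log (q_i^a(X) / q_j^a(X)))²] < ∞` for all `i`, `j`, `a`. The logarithm is extended-valued, so
that the second moment is infinite if `q_j^a` vanishes with positive probability. -/
def AssumptionI (m : Model M A X) : Prop :=
  ∀ (i j : Fin M) (a : A),
    ∫⁻ x, (ENNReal.log ((m.q i a x : ℝ≥0∞) / (m.q j a x : ℝ≥0∞))).abs ^ 2 ∂(m.obsLaw i a) < ∞

open Classical in
/-- `β = min_{i ≠ j, k} ∑_{a ∈ A_ij} lam_k(a)`. -/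
def beta [Fintype A] (m : Model M A X) (lam : Fin M → PMF A) : ℝ≥0∞ :=
  ⨅ (i : Fin M) (j : Fin M) (_ : i ≠ j) (k : Fin M),
    ∑ a, if a ∈ m.discriminating i j then lam k a else 0

end Model

/-- The independent variables that are available at one time `n`:
the switching indicator `U n`; for each hypothesis `k` a candidate action drawn from `lam k`;
for each nonempty set of hypotheses a uniform choice from it, for resolving ties;
and for each action `a` the observation that is made if `a` is the action at time `n`. -/
abbrev Seed (M : ℕ) (A X : Type*) : Type _ :=
  Bool × (Fin M → A) × ({S : Finset (Fin M) // S.Nonempty} → Fin M) × (A → X)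

/-- The sample space: the first action, and the variables of each time `n`. -/
abbrev Sample (M : ℕ) (A X : Type*) : Type _ := A × (ℕ → Seed M A X)

section Run

variable (ω : Sample M A X)

/-- The switching indicator `U_n`. -/
def switch (n : ℕ) : Bool := (ω.2 n).1

/-- The action that is drawn from `lam k` for use at time `n`. -/
def candidate (n : ℕ) (k : Fin M) : A := (ω.2 n).2.1 k

/-- The uniform choice from `S` at time `n`. -/
def tieBreak (n : ℕ) (S : {S : Finset (Fin M) // S.Nonempty}) : Fin M := (ω.2 n).2.2.1 S

/-- The observation at time `n` if the action at time `n` is `a`. -/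
def potentialObs (n : ℕ) (a : A) : X := (ω.2 n).2.2.2 a

/-- The set of the maximizers of `z`. -/
def argmaxSet [NeZero M] (z : Fin M → ℝ) : {S : Finset (Fin M) // S.Nonempty} :=
  ⟨Finset.univ.filter (fun i => ∀ j, z j ≤ z i), by
    obtain ⟨i, hi⟩ := Finite.exists_max z
    exact ⟨i, by simpa using hi⟩⟩

/-- The pair `(A_n, Z(n))` of the action at time `n` and the log-likelihoods
`Z_i(n) = ∑_{l = 1}^n log q_i^{A_l}(X_l)` after `n` observations. (In the joint density of
actions and observations the policy contributes one more factor, which is the same for all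
hypotheses; it changes neither the maximizers nor the differences `Z_i(n) - Z_j(n)`.)
The first action `A_1` is the one given by `ω`; the entry `A_0` is a placeholder. For `n ≥ 1`,
`A_{n+1}` is `A_n` if `U_{n+1} = 0`, and is drawn from `lam θ(n)` if `U_{n+1} = 1`, where `θ(n)` is
a maximizer of `Z(n)`, with ties resolved uniformly at random. -/
def state [NeZero M] (m : Model M A X) : ℕ → A × (Fin M → ℝ)
  | 0 => (ω.1, fun _ => 0)
  | n + 1 =>
    let θ : Fin M := tieBreak ω n (argmaxSet (state m n).2)
    let a : A :=
      if n = 0 then ω.1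
      else if switch ω (n + 1) = true then candidate ω (n + 1) θ
      else (state m n).1
    (a, fun i => (state m n).2 i + Real.log (m.q i a (potentialObs ω (n + 1) a)))

/-- The action `A_n`, for `n ≥ 1`. -/
def action [NeZero M] (m : Model M A X) (n : ℕ) : A := (state ω m n).1

/-- The log-likelihood `Z_i(n)`. -/
def Z [NeZero M] (m : Model M A X) (i : Fin M) (n : ℕ) : ℝ := (state ω m n).2 i

/-- The maximum likelihood hypothesis `θ(n)`. -/
def theta [NeZero M] (m : Model M A X) (n : ℕ) : Fin M :=
  tieBreak ω n (argmaxSet (fun i => Z ω m i n))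

/-- The test retires at time `n`: `Z_{θ(n),j}(n) ≥ log((M-1)L)` for all `j ≠ θ(n)`. -/
def Retires [NeZero M] (m : Model M A X) (L : ℝ) (n : ℕ) : Prop :=
  ∀ j, j ≠ theta ω m n → Real.log (((M : ℝ) - 1) * L) ≤ Z ω m (theta ω m n) n - Z ω m j n

/-- The stopping time `τ`, the first `n ≥ 1` at which the test retires (`∞` if there is none). -/
def stopTime [NeZero M] (m : Model M A X) (L : ℝ) : ℕ∞ :=
  ⨅ (n : ℕ) (_ : 1 ≤ n ∧ Retires ω m L n), (n : ℕ∞)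

open Classical in
/-- The total cost `C = τ + ∑_{l = 1}^{τ - 1} g(A_l, A_{l+1})`. -/
def totalCost [NeZero M] (m : Model M A X) (g : A → A → ℝ≥0) (L : ℝ) : ℝ≥0∞ :=
  (stopTime ω m L : ℝ≥0∞) +
    ∑' l : ℕ, if 1 ≤ l ∧ (l : ℕ∞) < stopTime ω m L then
      (g (action ω m l) (action ω m (l + 1)) : ℝ≥0∞) else 0

end Run

section Law

variable [MeasurableSpace A] [Fintype A]

/-- The joint law, under hypothesis `i`, of the variables of one time, which are independent. -/
def seedLaw (m : Model M A X) (lam : Fin M → PMF A) (η : unitInterval) (i : Fin M) :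
    Measure (Seed M A X) :=
  (bernoulliMeasure true false η).prod
    ((Measure.pi fun k => (lam k).toMeasure).prod
      ((Measure.pi fun S : {S : Finset (Fin M) // S.Nonempty} =>
          (PMF.uniformOfFinset S.1 S.2).toMeasure).prod
        (Measure.pi fun a => m.obsLaw i a)))

instance (m : Model M A X) (lam : Fin M → PMF A) (η : unitInterval) (i : Fin M) :
    IsProbabilityMeasure (seedLaw m lam η i) := by
  unfold seedLaw
  infer_instance

/-- The probability measure `P_i` of the sluggish procedure: the first action has law `ν`, and it
and the variables of all times are independent. Hence, given `A_n = a` and all that happened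
before, the observation `X_n = potentialObs n A_n` has the density `q i a`. -/
def law (m : Model M A X) (lam : Fin M → PMF A) (ν : PMF A) (η : unitInterval) (i : Fin M) :
    Measure (Sample M A X) :=
  ν.toMeasure.prod (Measure.infinitePi fun _ : ℕ => seedLaw m lam η i)

end Law

/-- The largest switching cost `g_max`. -/
def gMax [Fintype A] (g : A → A → ℝ≥0) : ℝ≥0 :=
  Finset.univ.sup fun p : A × A => g p.1 p.2

end ASHT

end

/-! A switching cost can be paid at time n + 1 only if U_{n+1} = 1, and U_{n+1} is independent of {n
< τ}. Hence the expected cost is at most (1 + g_max η) ∑ P(n < τ) (`lintegral_totalCost_le`), and it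
remains to bound this sum by (1 + o(1)) log L / D_i.

If the test has not retired by time n, where nD_i is somewhat above log((M-1)L), then almost surely
some Z_i(n) - Z_j(n) with j ≠ i is below n(D_i - ε). The core is that this event has geometrically
small probability (`measure_logRatio_le`); the tail sum is then O(1), and ε tends to 0 after L.

The estimate is a Chernoff bound. At s = 1/2, assumption (IIb) and η > 0 make the expected weight
exp(-s(Z_i - Z_j)) contract at every step, whatever the estimate and the present action, so θ(n) ≠ i
is geometrically unlikely (`measure_theta_ne_le`). While θ(n) = i, the drift should be at least D_i,
but the action is kept with probability 1 - η, so the one-step drift depends on A_n and only its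
average under λ_i is controlled. The corrector κ d(a), with d(a) = D(q_i^a ‖ q_j^a) and ηκ = 1 - η,
solves the Poisson equation of this lazy chain: added to the log-likelihood ratio, it makes the
drift exactly ∑ λ_i(a) d(a) ≥ D_i, independent of A_n (`eventually_corrected_step_le`). Being
bounded, it costs only a constant factor. Steps with θ(n) ≠ i add a geometrically decaying error to
the recursion (`lintegral_weight_corrector_succ`). -/

noncomputable section

namespace ASHT

/-! ### Exponential moments of a single log-likelihood ratio -/

section ExponentialMoments

/-- A log-likelihood ratio Y has a second moment and E exp(-Y) ≤ 1, but perhaps no other exponential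
moments. Taylor's bound suffices when -ty ≤ 1; beyond that the term 8 exp(-y) absorbs the large
negative values of y. -/
theorem exp_neg_mul_le (t y : ℝ) (ht : 0 ≤ t) (ht' : t ≤ 1 / 2) :
    Real.exp (-(t * y)) ≤ 1 - t * y + t ^ 2 * (y ^ 2 + 8 * Real.exp (-y)) := by
  have hy := Real.exp_pos (-y)
  have h8 : 0 ≤ t ^ 2 * (8 * Real.exp (-y)) := by positivity
  rcases lt_or_ge 1 (-(t * y)) with h | h
  · have hy0 : y < 0 := by
      by_contra hc
      have := mul_nonneg ht (not_lt.1 hc)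
      linarith
    have h1 : Real.exp (-(t * y)) ≤ Real.exp (-y / 2) := by
      apply Real.exp_le_exp.2
      nlinarith
    -- The constant 8 comes from u²/2 ≤ exp u at u = -y/2.
    have h2 : (-y / 2) ^ 2 / 2 ≤ Real.exp (-y / 2) := by
      have := Real.quadratic_le_exp_of_nonneg (x := -y / 2) (by linarith)
      linarith
    have h3 : Real.exp (-y) = Real.exp (-y / 2) * Real.exp (-y / 2) := by
      rw [← Real.exp_add]; ring_nf
    have h4 : y ^ 2 * Real.exp (-y / 2) ≤ 8 * Real.exp (-y) := by
      rw [h3]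
      nlinarith [Real.exp_pos (-y / 2)]
    have h5 : 1 ≤ t ^ 2 * y ^ 2 := by nlinarith
    have h6 : Real.exp (-(t * y)) ≤ t ^ 2 * (8 * Real.exp (-y)) := by
      calc Real.exp (-(t * y)) ≤ 1 * Real.exp (-y / 2) := by linarith
        _ ≤ t ^ 2 * y ^ 2 * Real.exp (-y / 2) := by gcongr
        _ = t ^ 2 * (y ^ 2 * Real.exp (-y / 2)) := by ring
        _ ≤ _ := by gcongr
    have : 0 ≤ t ^ 2 * y ^ 2 := by positivity
    nlinarith
  · suffices Real.exp (-(t * y)) ≤ 1 + -(t * y) + (-(t * y)) ^ 2 by nlinarith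
    rcases lt_or_ge (-(t * y)) (-1) with h' | h'
    · have : Real.exp (-(t * y)) ≤ 1 := Real.exp_le_one_iff.2 (by linarith)
      nlinarith
    · have := (abs_le.1 (Real.abs_exp_sub_one_sub_id_le (abs_le.2 ⟨h', h⟩))).2
      linarith

theorem exp_neg_mul_le_convex (t y : ℝ) (ht : 0 ≤ t) (ht' : t ≤ 1) :
    Real.exp (-(t * y)) ≤ (1 - t) + t * Real.exp (-y) := by
  have := convexOn_exp.2 (Set.mem_univ 0) (Set.mem_univ (-y)) (sub_nonneg.2 ht') ht (by ring)
  simpa using this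

theorem exp_neg_half_lt {y : ℝ} (hy : y ≠ 0) :
    Real.exp (-(1 / 2 * y)) < 1 / 2 + 1 / 2 * Real.exp (-y) := by
  have h3 : Real.exp (-y) = Real.exp (-(1 / 2 * y)) ^ 2 := by
    rw [← Real.exp_nat_mul]; congr 1; push_cast; ring
  have h4 : Real.exp (-(1 / 2 * y)) ≠ 1 := by
    rw [Ne, Real.exp_eq_one_iff]; intro h; apply hy; linarith
  have := sq_pos_of_ne_zero (sub_ne_zero.2 h4)
  rw [h3]; nlinarith

namespace Model

variable {M : ℕ} {A X : Type*} [MeasurableSpace X]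

variable (m : Model M A X)

/-- The log-likelihood ratio of hypotheses `i` and `j` for an observation made with action `a`. -/
def logRatio (i j : Fin M) (a : A) (x : X) : ℝ := Real.log (m.q i a x) - Real.log (m.q j a x)

theorem measurable_logRatio (i j : Fin M) (a : A) : Measurable (m.logRatio i j a) :=
  (Real.measurable_log.comp (measurable_coe_nnreal_real.comp (m.measurable_q i a))).sub
    (Real.measurable_log.comp (measurable_coe_nnreal_real.comp (m.measurable_q j a)))

theorem lintegral_obsLaw (i : Fin M) (a : A) {f : X → ℝ≥0∞} (hf : Measurable f) :
    ∫⁻ x, f x ∂m.obsLaw i a = ∫⁻ x, m.q i a x * f x ∂m.μ := by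
  rw [obsLaw, lintegral_withDensity_eq_lintegral_mul _ (m.measurable_q i a).coe_nnreal_ennreal hf]
  rfl

theorem ae_q_pos_self (i : Fin M) (a : A) : ∀ᵐ x ∂m.obsLaw i a, 0 < m.q i a x := by
  rw [obsLaw, ae_withDensity_iff (m.measurable_q i a).coe_nnreal_ennreal]
  filter_upwards with x hx
  exact pos_iff_ne_zero.2 (by simpa using hx)

variable {m}

/-- Where q_j vanishes and q_i does not, the extended logarithm is infinite, so a finite second
moment makes this set null. Hence the value `Real.log 0 = 0` never matters in `logRatio`. -/
theorem AssumptionI.ae_q_pos (hI : m.AssumptionI) (i j : Fin M) (a : A) :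
    ∀ᵐ x ∂m.obsLaw i a, 0 < m.q j a x := by
  have hmeas : Measurable fun x =>
      (ENNReal.log ((m.q i a x : ℝ≥0∞) / (m.q j a x : ℝ≥0∞))).abs ^ 2 := by
    have h1 := (m.measurable_q i a).coe_nnreal_ennreal
    have h2 := (m.measurable_q j a).coe_nnreal_ennreal
    have h3 : Measurable EReal.abs := by
      apply EReal.measurable_of_measurable_real
      exact ENNReal.measurable_ofReal.comp measurable_id.abs
    exact (h3.comp (ENNReal.measurable_log.comp (h1.div h2))).pow_const 2
  filter_upwards [ae_lt_top hmeas (hI i j a).ne, m.ae_q_pos_self i a] with x hx hxi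
  by_contra hc
  have h0 : m.q j a x = 0 := by simpa using hc
  simp [h0, ENNReal.div_zero, hxi.ne'] at hx

theorem AssumptionI.log_div_abs (hI : m.AssumptionI) (i j : Fin M) (a : A) :
    ∀ᵐ x ∂m.obsLaw i a, (ENNReal.log ((m.q i a x : ℝ≥0∞) / (m.q j a x : ℝ≥0∞))).abs ^ 2 =
      ENNReal.ofReal (m.logRatio i j a x ^ 2) := by
  filter_upwards [hI.ae_q_pos i j a, m.ae_q_pos_self i a] with x hj hi
  have hne : m.q i a x / m.q j a x ≠ 0 := (div_pos hi hj).ne'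
  rw [← ENNReal.coe_div hj.ne', ENNReal.log_of_nnreal hne, EReal.abs_def, ← ENNReal.ofReal_pow
    (abs_nonneg _), sq_abs, NNReal.coe_div, Real.log_div (by exact_mod_cast hi.ne')
    (by exact_mod_cast hj.ne'), logRatio]

theorem AssumptionI.integrable_logRatio_sq (hI : m.AssumptionI) (i j : Fin M) (a : A) :
    Integrable (fun x => m.logRatio i j a x ^ 2) (m.obsLaw i a) := by
  refine ⟨((m.measurable_logRatio i j a).pow_const 2).aestronglyMeasurable, ?_⟩
  rw [hasFiniteIntegral_iff_ofReal (ae_of_all _ fun _ => sq_nonneg _),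
    ← lintegral_congr_ae (hI.log_div_abs i j a)]
  exact hI i j a

theorem AssumptionI.integrable_logRatio (hI : m.AssumptionI) (i j : Fin M) (a : A) :
    Integrable (m.logRatio i j a) (m.obsLaw i a) := by
  refine ((integrable_const (1 : ℝ)).add (hI.integrable_logRatio_sq i j a)).mono'
    (m.measurable_logRatio i j a).aestronglyMeasurable (ae_of_all _ fun x => ?_)
  simp only [Pi.add_apply, Real.norm_eq_abs]
  nlinarith [abs_nonneg (m.logRatio i j a x), sq_abs (m.logRatio i j a x),
    sq_nonneg (|m.logRatio i j a x| - 1)]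

/-- Change of measure: exp(-Y) is q_j / q_i, whose integral against q_i is the mass of q_j where q_i
is positive. -/
theorem AssumptionI.lintegral_exp_neg_logRatio (hI : m.AssumptionI) (i j : Fin M) (a : A) :
    ∫⁻ x, ENNReal.ofReal (Real.exp (-m.logRatio i j a x)) ∂m.obsLaw i a ≤ 1 := by
  have hm : Measurable fun x => ENNReal.ofReal (Real.exp (-m.logRatio i j a x)) :=
    (m.measurable_logRatio i j a).neg.exp.ennreal_ofReal
  have h : ∀ᵐ x ∂m.obsLaw i a, ENNReal.ofReal (Real.exp (-m.logRatio i j a x)) =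
      (m.q j a x : ℝ≥0∞) / m.q i a x := by
    filter_upwards [hI.ae_q_pos i j a, m.ae_q_pos_self i a] with x hj hi
    rw [logRatio, neg_sub, Real.exp_sub, Real.exp_log (by exact_mod_cast hj),
      Real.exp_log (by exact_mod_cast hi), ← NNReal.coe_div, ENNReal.ofReal_coe_nnreal,
      ENNReal.coe_div hi.ne']
  have hd : Measurable fun x => (m.q j a x : ℝ≥0∞) / m.q i a x :=
    (m.measurable_q j a).coe_nnreal_ennreal.div (m.measurable_q i a).coe_nnreal_ennreal
  rw [lintegral_congr_ae h, m.lintegral_obsLaw i a hd, ← m.lintegral_q j a]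
  exact lintegral_mono fun x => ENNReal.mul_div_le

theorem AssumptionI.integrable_exp_neg_logRatio (hI : m.AssumptionI) (i j : Fin M) (a : A) :
    Integrable (fun x => Real.exp (-m.logRatio i j a x)) (m.obsLaw i a) := by
  refine ⟨(m.measurable_logRatio i j a).neg.exp.aestronglyMeasurable, ?_⟩
  rw [hasFiniteIntegral_iff_ofReal (ae_of_all _ fun _ => (Real.exp_pos _).le)]
  exact (hI.lintegral_exp_neg_logRatio i j a).trans_lt ENNReal.one_lt_top

theorem AssumptionI.integral_exp_neg_logRatio (hI : m.AssumptionI) (i j : Fin M) (a : A) :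
    ∫ x, Real.exp (-m.logRatio i j a x) ∂m.obsLaw i a ≤ 1 := by
  rw [← ENNReal.ofReal_le_one, ofReal_integral_eq_lintegral_ofReal
    (hI.integrable_exp_neg_logRatio i j a) (ae_of_all _ fun _ => (Real.exp_pos _).le)]
  exact hI.lintegral_exp_neg_logRatio i j a

theorem AssumptionI.integrable_exp_neg_mul_logRatio (hI : m.AssumptionI) (i j : Fin M) (a : A)
    {s : ℝ} (hs : 0 ≤ s) (hs' : s ≤ 1) :
    Integrable (fun x => Real.exp (-(s * m.logRatio i j a x))) (m.obsLaw i a) := by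
  refine (((integrable_const (1 - s)).add
    ((hI.integrable_exp_neg_logRatio i j a).const_mul s))).mono'
    ((m.measurable_logRatio i j a).const_mul s).neg.exp.aestronglyMeasurable
    (ae_of_all _ fun x => ?_)
  rw [Real.norm_eq_abs, Real.abs_exp]
  exact exp_neg_mul_le_convex s _ hs hs'

/-- The moment generating function of the log-likelihood ratio at `-s`. -/
def mgf (m : Model M A X) (i j : Fin M) (s : ℝ) (a : A) : ℝ :=
  ∫ x, Real.exp (-(s * m.logRatio i j a x)) ∂m.obsLaw i a

theorem mgf_nonneg (i j : Fin M) (s : ℝ) (a : A) : 0 ≤ m.mgf i j s a :=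
  integral_nonneg fun _ => (Real.exp_pos _).le

theorem AssumptionI.lintegral_exp_eq (hI : m.AssumptionI) (i j : Fin M) (a : A)
    {s : ℝ} (hs : 0 ≤ s) (hs' : s ≤ 1) :
    ∫⁻ x, ENNReal.ofReal (Real.exp (-(s * m.logRatio i j a x))) ∂m.obsLaw i a =
      ENNReal.ofReal (m.mgf i j s a) :=
  (ofReal_integral_eq_lintegral_ofReal (hI.integrable_exp_neg_mul_logRatio i j a hs hs')
    (ae_of_all _ fun _ => (Real.exp_pos _).le)).symm

theorem AssumptionI.mgf_le_one (hI : m.AssumptionI) (i j : Fin M) (a : A)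
    {s : ℝ} (hs : 0 ≤ s) (hs' : s ≤ 1) : m.mgf i j s a ≤ 1 := by
  calc m.mgf i j s a ≤ ∫ x, ((1 - s) + s * Real.exp (-m.logRatio i j a x)) ∂m.obsLaw i a :=
        integral_mono (hI.integrable_exp_neg_mul_logRatio i j a hs hs')
          ((integrable_const (1 - s)).add ((hI.integrable_exp_neg_logRatio i j a).const_mul s))
          fun x => exp_neg_mul_le_convex s _ hs hs'
    _ = (1 - s) + s * ∫ x, Real.exp (-m.logRatio i j a x) ∂m.obsLaw i a := by
        rw [integral_add (integrable_const _)
          ((hI.integrable_exp_neg_logRatio i j a).const_mul s), integral_const_mul]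
        simp
    _ ≤ 1 := by nlinarith [hI.integral_exp_neg_logRatio i j a]

/-- Identifies the Radon–Nikodym derivative, and so ties the abstract `klDiv` to the integral of
`logRatio`. -/
theorem AssumptionI.withDensity_obsLaw (hI : m.AssumptionI) (i j : Fin M) (a : A) :
    (m.obsLaw j a).withDensity (fun x => (m.q i a x : ℝ≥0∞) / m.q j a x) = m.obsLaw i a := by
  have h1 := (m.measurable_q i a).coe_nnreal_ennreal
  have h2 := (m.measurable_q j a).coe_nnreal_ennreal
  have hd : Measurable fun x => (m.q i a x : ℝ≥0∞) / m.q j a x := h1.div h2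
  rw [obsLaw, ← withDensity_mul _ h2 hd, obsLaw]
  refine withDensity_congr_ae ?_
  have := hI.ae_q_pos i j a
  rw [obsLaw, ae_withDensity_iff h1] at this
  filter_upwards [this] with x hx
  by_cases hi : (m.q i a x : ℝ≥0∞) = 0
  · simp [hi]
  · have := (hx hi).ne'
    exact ENNReal.mul_div_cancel (ENNReal.coe_ne_zero.2 this) ENNReal.coe_ne_top

theorem AssumptionI.absolutelyContinuous (hI : m.AssumptionI) (i j : Fin M) (a : A) :
    m.obsLaw i a ≪ m.obsLaw j a := by
  rw [← hI.withDensity_obsLaw i j a]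
  exact withDensity_absolutelyContinuous _ _

theorem AssumptionI.llr_ae_eq (hI : m.AssumptionI) (i j : Fin M) (a : A) :
    llr (m.obsLaw i a) (m.obsLaw j a) =ᵐ[m.obsLaw i a] m.logRatio i j a := by
  have h1 := (m.measurable_q i a).coe_nnreal_ennreal
  have h2 := (m.measurable_q j a).coe_nnreal_ennreal
  have h := Measure.rnDeriv_withDensity (m.obsLaw j a) (h1.div h2)
  have h' := hI.withDensity_obsLaw i j a
  simp only [Pi.div_def] at h
  rw [h'] at h
  filter_upwards [(hI.absolutelyContinuous i j a).ae_le h, hI.ae_q_pos i j a,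
    m.ae_q_pos_self i a] with x hx hj hi
  rw [llr, hx, logRatio, ENNReal.toReal_div, Real.log_div (by simpa using hi.ne')
    (by simpa using hj.ne')]
  simp

theorem AssumptionI.relEnt_ne_top (hI : m.AssumptionI) (i j : Fin M) (a : A) :
    m.relEnt i j a ≠ ⊤ :=
  InformationTheory.klDiv_ne_top (hI.absolutelyContinuous i j a)
    ((integrable_congr (hI.llr_ae_eq i j a)).2 (hI.integrable_logRatio i j a))

theorem AssumptionI.toReal_relEnt (hI : m.AssumptionI) (i j : Fin M) (a : A) :
    (m.relEnt i j a).toReal = ∫ x, m.logRatio i j a x ∂m.obsLaw i a := by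
  rw [relEnt, InformationTheory.toReal_klDiv_of_measure_eq (hI.absolutelyContinuous i j a)
    (by simp), integral_congr_ae (hI.llr_ae_eq i j a)]

/-- Equality would be equality in exp(-y/2) ≤ (1 + exp(-y))/2 almost everywhere, which forces y = 0
and hence zero relative entropy. -/
theorem AssumptionI.mgf_half_lt_one (hI : m.AssumptionI) {i j : Fin M} {a : A}
    (ha : a ∈ m.discriminating i j) : m.mgf i j (1 / 2) a < 1 := by
  refine lt_of_le_of_ne (hI.mgf_le_one i j a (by norm_num) (by norm_num)) fun h => ?_
  have i1 : Integrable (fun x => 1 / 2 + 1 / 2 * Real.exp (-m.logRatio i j a x))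
      (m.obsLaw i a) :=
    (integrable_const _).add ((hI.integrable_exp_neg_logRatio i j a).const_mul _)
  have i2 : Integrable (fun x => Real.exp (-(1 / 2 * m.logRatio i j a x))) (m.obsLaw i a) :=
    hI.integrable_exp_neg_mul_logRatio i j a (by norm_num) (by norm_num)
  have hint : Integrable (fun x => (1 / 2 + 1 / 2 * Real.exp (-m.logRatio i j a x)) -
      Real.exp (-(1 / 2 * m.logRatio i j a x))) (m.obsLaw i a) := i1.sub i2
  have hnn : ∀ x, 0 ≤ (1 / 2 + 1 / 2 * Real.exp (-m.logRatio i j a x)) -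
      Real.exp (-(1 / 2 * m.logRatio i j a x)) := fun x => by
    have := exp_neg_mul_le_convex (1 / 2) (m.logRatio i j a x) (by norm_num) (by norm_num)
    linarith
  have h0 : ∫ x, ((1 / 2 + 1 / 2 * Real.exp (-m.logRatio i j a x)) -
      Real.exp (-(1 / 2 * m.logRatio i j a x))) ∂m.obsLaw i a = 0 := by
    refine le_antisymm ?_ (integral_nonneg hnn)
    rw [integral_sub i1 i2, integral_add (integrable_const _)
      ((hI.integrable_exp_neg_logRatio i j a).const_mul _), integral_const_mul]
    have := hI.integral_exp_neg_logRatio i j a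
    rw [mgf] at h
    rw [h]
    simp
    linarith
  have hz : m.logRatio i j a =ᵐ[m.obsLaw i a] 0 := by
    filter_upwards [(integral_eq_zero_iff_of_nonneg hnn hint).1 h0] with x hx
    by_contra hc
    have := exp_neg_half_lt hc
    simp only [Pi.zero_apply] at hx
    linarith
  have h1 : (m.relEnt i j a).toReal = 0 := by
    rw [hI.toReal_relEnt, integral_congr_ae hz]; simp
  exact (ENNReal.toReal_pos (ne_of_gt ha) (hI.relEnt_ne_top i j a)).ne' h1

theorem AssumptionI.mgf_le (hI : m.AssumptionI) (i j : Fin M) (a : A) {s : ℝ} (hs : 0 ≤ s)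
    (hs' : s ≤ 1 / 2) :
    m.mgf i j s a ≤ 1 - s * (m.relEnt i j a).toReal +
      s ^ 2 * ((∫ x, m.logRatio i j a x ^ 2 ∂m.obsLaw i a) + 8) := by
  have i1 := hI.integrable_logRatio i j a
  have i2 := hI.integrable_logRatio_sq i j a
  have i3 := hI.integrable_exp_neg_logRatio i j a
  have i4 : Integrable (fun x => 1 - s * m.logRatio i j a x) (m.obsLaw i a) :=
    (integrable_const _).sub (i1.const_mul s)
  have i5 : Integrable (fun x => m.logRatio i j a x ^ 2 + 8 * Real.exp (-m.logRatio i j a x))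
      (m.obsLaw i a) := i2.add (i3.const_mul 8)
  have i6 := i5.const_mul (s ^ 2)
  have e4 : ∫ x, (1 - s * m.logRatio i j a x) ∂m.obsLaw i a =
      1 - s * ∫ x, m.logRatio i j a x ∂m.obsLaw i a := by
    rw [integral_sub (integrable_const _) (i1.const_mul s), integral_const_mul]
    simp
  have e5 : ∫ x, (m.logRatio i j a x ^ 2 + 8 * Real.exp (-m.logRatio i j a x)) ∂m.obsLaw i a =
      (∫ x, m.logRatio i j a x ^ 2 ∂m.obsLaw i a) +
        8 * ∫ x, Real.exp (-m.logRatio i j a x) ∂m.obsLaw i a := by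
    rw [integral_add i2 (i3.const_mul 8), integral_const_mul]
  have key : m.mgf i j s a ≤ ∫ x, (1 - s * m.logRatio i j a x + s ^ 2 * (m.logRatio i j a x ^ 2 +
        8 * Real.exp (-m.logRatio i j a x))) ∂m.obsLaw i a :=
    integral_mono (hI.integrable_exp_neg_mul_logRatio i j a hs (by linarith)) (i4.add i6)
      fun x => exp_neg_mul_le s _ hs hs'
  rw [integral_add i4 i6, integral_const_mul, e4, e5] at key
  rw [hI.toReal_relEnt]
  refine key.trans ?_
  have h1 := mul_le_mul_of_nonneg_left (hI.integral_exp_neg_logRatio i j a) (sq_nonneg s)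
  linarith

end Model
end ExponentialMoments

/-! ### Resampling the variables of one time -/

section Sampling

variable {M : ℕ} {A X : Type*} [MeasurableSpace X]

/-- Resampling one coordinate of an infinite product of probability measures preserves it. -/
theorem measurePreserving_update_infinitePi {ι : Type*} [DecidableEq ι] {E : Type*}
    [MeasurableSpace E] (p : Measure E) [IsProbabilityMeasure p] (n : ι) :
    MeasurePreserving (fun z : (ι → E) × E => Function.update z.1 n z.2)
      ((Measure.infinitePi fun _ : ι => p).prod p) (Measure.infinitePi fun _ : ι => p) := by
  have hm : Measurable fun z : (ι → E) × E => Function.update z.1 n z.2 := by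
    refine measurable_pi_lambda _ fun k => ?_
    by_cases hk : k = n
    · subst hk; simpa using measurable_snd
    · simpa [Function.update_of_ne hk, Function.comp_def] using
        (measurable_pi_apply k).comp measurable_fst
  refine ⟨hm, Measure.eq_infinitePi _ fun s t ht => ?_⟩
  rw [Measure.map_apply hm (MeasurableSet.pi s.countable_toSet fun k _ => ht k)]
  -- The preimage of a box is a product: coordinate n is constrained only through the fresh
  -- variable, the others only through the old ones.
  have hpre : (fun z : (ι → E) × E => Function.update z.1 n z.2) ⁻¹' (Set.pi s t) =
      (Set.pi (s.erase n : Finset ι) t) ×ˢ (if n ∈ s then t n else Set.univ) := by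
    ext z
    simp only [Set.mem_preimage, Set.mem_pi, Finset.mem_coe, Set.mem_prod, Finset.mem_erase]
    constructor
    · intro h
      refine ⟨fun k hk => by simpa [Function.update_of_ne hk.1] using h k hk.2, ?_⟩
      split_ifs with hn
      · simpa using h n hn
      · trivial
    · rintro ⟨h1, h2⟩ k hk
      by_cases hkn : k = n
      · subst hkn; simpa [hk] using h2
      · simpa [Function.update_of_ne hkn] using h1 k ⟨hkn, hk⟩
  rw [hpre, Measure.prod_prod, Measure.infinitePi_pi _ fun k _ => ht k]
  split_ifs with hn
  · rw [mul_comm, Finset.mul_prod_erase s (fun k => p (t k)) hn]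
  · rw [measure_univ, mul_one, Finset.erase_eq_of_notMem hn]

section Law

variable [MeasurableSpace A]

instance [Fintype A] (m : Model M A X) (lam : Fin M → PMF A) (ν : PMF A) (η : unitInterval)
    (i : Fin M) : IsProbabilityMeasure (law m lam ν η i) := by
  unfold law
  infer_instance

/-- The sample in which the variables of time `n` are replaced by `s`. -/
def resample (n : ℕ) (ω : Sample M A X) (s : Seed M A X) : Sample M A X :=
  (ω.1, Function.update ω.2 n s)

theorem measurable_seed (n : ℕ) : Measurable fun ω : Sample M A X => ω.2 n :=
  (measurable_pi_apply n).comp measurable_snd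

theorem measurable_resample (n : ℕ) :
    Measurable fun z : Sample M A X × Seed M A X => resample n z.1 z.2 := by
  refine (measurable_fst.comp measurable_fst).prodMk (measurable_pi_lambda _ fun k => ?_)
  by_cases hk : k = n
  · subst hk; simpa using measurable_snd
  · simpa [Function.update_of_ne hk, Function.comp_def] using
      (measurable_pi_apply k).comp (measurable_snd.comp measurable_fst)

variable [Fintype A]

theorem lintegral_resample (m : Model M A X) (lam : Fin M → PMF A) (ν : PMF A)
    (η : unitInterval) (i : Fin M) (n : ℕ) {F : Sample M A X → ℝ≥0∞} (hF : Measurable F) :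
    ∫⁻ ω, F ω ∂law m lam ν η i =
      ∫⁻ ω, ∫⁻ s, F (resample n ω s) ∂seedLaw m lam η i ∂law m lam ν η i := by
  have hFr := hF.comp (measurable_resample (M := M) (A := A) (X := X) n)
  have hin : Measurable fun ω : Sample M A X =>
      ∫⁻ s, F (resample n ω s) ∂seedLaw m lam η i := hFr.lintegral_prod_right'
  rw [law, lintegral_prod _ hF.aemeasurable, lintegral_prod _ hin.aemeasurable]
  refine lintegral_congr fun a => ?_
  have hFa : Measurable fun f : ℕ → Seed M A X => F (a, f) := hF.comp measurable_prodMk_left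
  have h := measurePreserving_update_infinitePi (seedLaw m lam η i) n
  rw [← h.lintegral_comp hFa]
  exact lintegral_prod _ (hFa.comp h.measurable).aemeasurable

/-- The conditional expectation of a function of the variables of time `n`, given variables that do
not depend on these. -/
theorem lintegral_of_resample_eq (m : Model M A X) (lam : Fin M → PMF A) (ν : PMF A)
    (η : unitInterval) (i : Fin M) (n : ℕ) {F : Sample M A X → Seed M A X → ℝ≥0∞}
    (hF : Measurable fun ω => F ω (ω.2 n)) (h : ∀ ω s, F (resample n ω s) = F ω) :
    ∫⁻ ω, F ω (ω.2 n) ∂law m lam ν η i =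
      ∫⁻ ω, ∫⁻ s, F ω s ∂seedLaw m lam η i ∂law m lam ν η i := by
  rw [lintegral_resample m lam ν η i n hF]
  simp only [h]
  simp [resample]

end Law

section Seed

variable [Fintype A] [MeasurableSpace A]

theorem lintegral_bernoulliMeasure (η : unitInterval) (f : Bool → ℝ≥0∞) :
    ∫⁻ b, f b ∂bernoulliMeasure true false η =
      ENNReal.ofReal η * f true + ENNReal.ofReal (1 - η) * f false := by
  rw [bernoulliMeasure_def, lintegral_add_measure]
  simp only [ENNReal.smul_def, lintegral_smul_measure, lintegral_dirac]
  have h (x : unitInterval) : ((unitInterval.toNNReal x : ℝ≥0) : ℝ≥0∞) = ENNReal.ofReal x :=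
    (ENNReal.ofReal_eq_coe_nnreal x.2.1).symm
  rw [h, h, unitInterval.coe_symm_eq]
  rfl

theorem lintegral_pmf [DiscreteMeasurableSpace A] (p : PMF A) (f : A → ℝ≥0∞) :
    ∫⁻ a, f a ∂p.toMeasure = ∑ a, p a * f a := by
  rw [lintegral_fintype]
  exact Finset.sum_congr rfl fun a _ => by
    rw [PMF.toMeasure_apply_singleton _ _ (measurableSet_singleton a), mul_comm]

/-- Expectations over the variables of one time, of a function of the next action and of the
observation made with it. -/
theorem lintegral_seedLaw [DiscreteMeasurableSpace A] (m : Model M A X) (lam : Fin M → PMF A)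
    (η : unitInterval) (i k : Fin M) (a : A) {G : A → X → ℝ≥0∞} (hG : ∀ a, Measurable (G a)) :
    ∫⁻ s : Seed M A X, G (if s.1 = true then s.2.1 k else a)
        (s.2.2.2 (if s.1 = true then s.2.1 k else a)) ∂seedLaw m lam η i =
      ENNReal.ofReal η * ∑ b, lam k b * ∫⁻ x, G b x ∂m.obsLaw i b +
        ENNReal.ofReal (1 - η) * ∫⁻ x, G a x ∂m.obsLaw i a := by
  have hG' : Measurable fun z : A × X => G z.1 z.2 := measurable_from_prod_countable_right hG
  have hev : Measurable fun z : A × (A → X) => z.2 z.1 :=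
    measurable_from_prod_countable_right fun b => measurable_pi_apply b
  have hact : Measurable fun s : Seed M A X => if s.1 = true then s.2.1 k else a :=
    Measurable.ite (measurableSet_eq_fun measurable_fst measurable_const)
      ((measurable_pi_apply k).comp (measurable_fst.comp measurable_snd)) measurable_const
  have hobs : Measurable fun s : Seed M A X => s.2.2.2 :=
    measurable_snd.comp (measurable_snd.comp measurable_snd)
  have hF : Measurable fun s : Seed M A X => G (if s.1 = true then s.2.1 k else a)
      (s.2.2.2 (if s.1 = true then s.2.1 k else a)) :=
    hG'.comp (hact.prodMk (hev.comp (hact.prodMk hobs)))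
  have hfix (b : A) : ∫⁻ z : ({S : Finset (Fin M) // S.Nonempty} → Fin M) × (A → X), G b (z.2 b)
      ∂((Measure.pi fun S : {S : Finset (Fin M) // S.Nonempty} =>
          (PMF.uniformOfFinset S.1 S.2).toMeasure).prod (Measure.pi fun a => m.obsLaw i a)) =
      ∫⁻ x, G b x ∂m.obsLaw i b := by
    have h1 : Measurable fun o : A → X => G b (o b) := (hG b).comp (measurable_pi_apply b)
    refine (lintegral_prod _ (h1.comp measurable_snd).aemeasurable).trans ?_
    simp only [Function.comp_apply]
    rw [lintegral_const, measure_univ, mul_one]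
    exact (measurePreserving_eval (fun a => m.obsLaw i a) b).lintegral_comp (hG b)
  rw [seedLaw, lintegral_prod _ hF.aemeasurable, lintegral_bernoulliMeasure]
  congr 2
  · refine (lintegral_prod _ (hF.comp measurable_prodMk_left).aemeasurable).trans ?_
    simp only [Function.comp_apply, if_true, hfix]
    rw [← lintegral_pmf (lam k) fun b => ∫⁻ x, G b x ∂m.obsLaw i b]
    exact (measurePreserving_eval (fun k => (lam k).toMeasure) k).lintegral_comp
      (f := fun b => ∫⁻ x, G b x ∂m.obsLaw i b) .of_discrete
  · refine (lintegral_prod _ (hF.comp measurable_prodMk_left).aemeasurable).trans ?_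
    simp [hfix]

theorem lintegral_seedLaw_obs (m : Model M A X) (lam : Fin M → PMF A) (η : unitInterval)
    (i : Fin M) (a : A) {G : X → ℝ≥0∞} (hG : Measurable G) :
    ∫⁻ s : Seed M A X, G (s.2.2.2 a) ∂seedLaw m lam η i = ∫⁻ x, G x ∂m.obsLaw i a := by
  have h : MeasurePreserving (fun s : Seed M A X => s.2.2.2 a) (seedLaw m lam η i)
      (m.obsLaw i a) :=
    (measurePreserving_eval (fun a => m.obsLaw i a) a).comp (measurePreserving_snd.comp
      (measurePreserving_snd.comp measurePreserving_snd))
  exact h.lintegral_comp hG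

theorem measurePreserving_tieBreak (m : Model M A X) (lam : Fin M → PMF A) (ν : PMF A)
    (η : unitInterval) (i : Fin M) (n : ℕ) (S : {S : Finset (Fin M) // S.Nonempty}) :
    MeasurePreserving (fun ω : Sample M A X => tieBreak ω n S) (law m lam ν η i)
      (PMF.uniformOfFinset S.1 S.2).toMeasure :=
  (measurePreserving_eval (fun S : {S : Finset (Fin M) // S.Nonempty} =>
      (PMF.uniformOfFinset S.1 S.2).toMeasure) S).comp (measurePreserving_fst.comp
    (measurePreserving_snd.comp (measurePreserving_snd.comp
      ((measurePreserving_eval_infinitePi (fun _ : ℕ => seedLaw m lam η i) n).comp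
        measurePreserving_snd))))

/-- The tie-break variable takes values in all of `Fin M` and lies in S only almost surely, so θ(n)
is a maximizer only almost surely. -/
theorem ae_tieBreak_mem (m : Model M A X) (lam : Fin M → PMF A) (ν : PMF A)
    (η : unitInterval) (i : Fin M) :
    ∀ᵐ ω ∂law m lam ν η i, ∀ n S, tieBreak ω n S ∈ S.1 := by
  refine ae_all_iff.2 fun n => ae_all_iff.2 fun S => ?_
  refine (measurePreserving_tieBreak m lam ν η i n S).quasiMeasurePreserving.ae (p := (· ∈ S.1)) ?_
  rw [ae_iff, PMF.toMeasure_apply_eq_zero_iff _ (Set.toFinite _).measurableSet]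
  rw [PMF.support_uniformOfFinset, Set.disjoint_left]
  intro k hk
  simpa using hk

theorem lintegral_seedLaw_switch (m : Model M A X) (lam : Fin M → PMF A) (η : unitInterval)
    (i : Fin M) : ∫⁻ s : Seed M A X, (if s.1 = true then 1 else 0) ∂seedLaw m lam η i =
      ENNReal.ofReal η := by
  have hm : Measurable fun s : Seed M A X => if s.1 = true then (1 : ℝ≥0∞) else 0 :=
    Measurable.ite (measurableSet_eq_fun measurable_fst measurable_const) measurable_const
      measurable_const
  rw [seedLaw, lintegral_prod _ hm.aemeasurable, lintegral_bernoulliMeasure]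
  simp

end Seed

end Sampling

/-! ### Dependence on the past and measurability of the trajectory -/

section Trajectory

variable {M : ℕ} [NeZero M] {A X : Type*} [MeasurableSpace X] (m : Model M A X)

theorem theta_eq (ω : Sample M A X) (n : ℕ) :
    theta ω m n = tieBreak ω n (argmaxSet (state ω m n).2) := rfl

/-- The log-likelihoods after the observation that is made at one time with action `a`. -/
def addObs (z : Fin M → ℝ) (a : A) (s : Seed M A X) : Fin M → ℝ :=
  fun k => z k + Real.log (m.q k a (s.2.2.2 a))

/-- The next action, if the variables of the next time are `s`, the maximum likelihood hypothesis
is `k` and the present action is `a`. -/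
def nextAction (k : Fin M) (a : A) (s : Seed M A X) : A := if s.1 = true then s.2.1 k else a

theorem state_succ_eq_ite (ω : Sample M A X) (n : ℕ) :
    state ω m (n + 1) =
      (if n = 0 then ω.1 else nextAction (theta ω m n) (state ω m n).1 (ω.2 (n + 1)),
        addObs m (state ω m n).2
          (if n = 0 then ω.1 else nextAction (theta ω m n) (state ω m n).1 (ω.2 (n + 1)))
          (ω.2 (n + 1))) := rfl

theorem state_succ (ω : Sample M A X) {n : ℕ} (hn : n ≠ 0) :
    state ω m (n + 1) =
      (nextAction (theta ω m n) (state ω m n).1 (ω.2 (n + 1)),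
        addObs m (state ω m n).2 (nextAction (theta ω m n) (state ω m n).1 (ω.2 (n + 1)))
          (ω.2 (n + 1))) := by
  simp only [state_succ_eq_ite, hn, if_false]

theorem action_succ (ω : Sample M A X) {n : ℕ} (hn : n ≠ 0) :
    action ω m (n + 1) = nextAction (theta ω m n) (action ω m n) (ω.2 (n + 1)) := by
  rw [action, state_succ m ω hn]
  rfl

/-- Adaptedness: with `lintegral_of_resample_eq`, this replaces conditioning on a filtration. -/
theorem state_resample (ω : Sample M A X) {k n : ℕ} (h : n < k) (s : Seed M A X) :
    state (resample k ω s) m n = state ω m n := by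
  induction n with
  | zero => rfl
  | succ n ih =>
    have h1 : (resample k ω s).2 (n + 1) = ω.2 (n + 1) := Function.update_of_ne h.ne _ _
    have h2 : (resample k ω s).2 n = ω.2 n := Function.update_of_ne (by omega) _ _
    have h3 : (resample k ω s).1 = ω.1 := rfl
    simp only [state_succ_eq_ite, theta_eq, tieBreak, ih (by omega), h1, h2, h3]

theorem theta_resample (ω : Sample M A X) {k n : ℕ} (h : n < k) (s : Seed M A X) :
    theta (resample k ω s) m n = theta ω m n := by
  have h2 : (resample k ω s).2 n = ω.2 n := Function.update_of_ne h.ne _ _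
  rw [theta_eq, theta_eq, state_resample m ω h, tieBreak, tieBreak, h2]

/-- The test has not stopped by time `n`. -/
theorem lt_stopTime_iff {ω : Sample M A X} {L : ℝ} {n : ℕ} :
    (n : ℕ∞) < stopTime ω m L ↔ ∀ k ∈ Finset.Icc 1 n, ¬ Retires ω m L k := by
  constructor
  · intro h k hk hr
    rw [Finset.mem_Icc] at hk
    have h1 : stopTime ω m L ≤ (k : ℕ∞) := iInf₂_le k ⟨hk.1, hr⟩
    have h2 : (k : ℕ∞) ≤ n := by exact_mod_cast hk.2
    exact absurd (h.trans_le (h1.trans h2)) (lt_irrefl _)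
  · intro h
    have h1 : ((n + 1 : ℕ) : ℕ∞) ≤ stopTime ω m L := by
      refine le_iInf₂ fun k hk => ?_
      by_contra hc
      have : k < n + 1 := by exact_mod_cast not_le.1 hc
      exact h k (Finset.mem_Icc.2 ⟨hk.1, by omega⟩) hk.2
    refine lt_of_lt_of_le ?_ h1
    exact_mod_cast Nat.lt_succ_self n

theorem lt_stopTime_resample (ω : Sample M A X) (L : ℝ) {k n : ℕ} (h : n < k) (s : Seed M A X) :
    (n : ℕ∞) < stopTime (resample k ω s) m L ↔ (n : ℕ∞) < stopTime ω m L := by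
  rw [lt_stopTime_iff, lt_stopTime_iff]
  refine forall₂_congr fun l hl => ?_
  rw [Finset.mem_Icc] at hl
  simp only [Retires, Z, theta_resample m ω (show l < k by omega),
    state_resample m ω (show l < k by omega)]

/-- There are finitely many possible sets of maximizers, so θ(n) is measurable by splitting over
them. -/
theorem measurableSet_argmaxSet_eq (S : {S : Finset (Fin M) // S.Nonempty}) :
    MeasurableSet {z : Fin M → ℝ | argmaxSet z = S} := by
  have : {z : Fin M → ℝ | argmaxSet z = S} =
      ⋂ k, {z | k ∈ S.1 ↔ ∀ j, z j ≤ z k} := by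
    ext z
    simp only [argmaxSet, Set.mem_ofPred_eq, Subtype.ext_iff, Finset.ext_iff, Finset.mem_filter,
      Finset.mem_univ, true_and, Set.mem_iInter]
    exact forall_congr' fun k => Iff.comm
  rw [this]
  refine MeasurableSet.iInter fun k => ?_
  have h1 : MeasurableSet {z : Fin M → ℝ | ∀ j, z j ≤ z k} := by
    simp only [Set.ofPred_forall]
    exact MeasurableSet.iInter fun j =>
      measurableSet_le (measurable_pi_apply j) (measurable_pi_apply k)
  by_cases hk : k ∈ S.1
  · simpa [hk] using h1
  · simp only [hk, false_iff]
    exact h1.compl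

variable [MeasurableSpace A]

theorem measurable_tieBreak_argmaxSet (n : ℕ) {f : Sample M A X → Fin M → ℝ}
    (hf : Measurable f) : Measurable fun ω => tieBreak ω n (argmaxSet (f ω)) := by
  refine measurable_to_countable' fun k => ?_
  have : (fun ω => tieBreak ω n (argmaxSet (f ω))) ⁻¹' {k} =
      ⋃ S : {S : Finset (Fin M) // S.Nonempty},
        f ⁻¹' {z | argmaxSet z = S} ∩ {ω | tieBreak ω n S = k} := by
    ext ω
    simp
  rw [this]
  refine MeasurableSet.iUnion fun S => (hf (measurableSet_argmaxSet_eq S)).inter ?_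
  have h : Measurable fun ω : Sample M A X => tieBreak ω n S :=
    (measurable_pi_apply S).comp (measurable_fst.comp (measurable_snd.comp (measurable_snd.comp
      (measurable_seed n))))
  exact h (measurableSet_singleton k)

variable [Finite A] [DiscreteMeasurableSpace A]

theorem measurable_state (n : ℕ) : Measurable fun ω : Sample M A X => state ω m n := by
  induction n with
  | zero => exact measurable_fst.prodMk measurable_const
  | succ n ih =>
    have hθ := measurable_tieBreak_argmaxSet n (measurable_snd.comp ih)
    have hc : Measurable fun ω : Sample M A X =>
        candidate ω (n + 1) (tieBreak ω n (argmaxSet (state ω m n).2)) := by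
      have h : Measurable fun z : Fin M × (Fin M → A) => z.2 z.1 :=
        measurable_from_prod_countable_right fun b => measurable_pi_apply b
      exact h.comp (hθ.prodMk (measurable_fst.comp (measurable_snd.comp (measurable_seed (n + 1)))))
    have hsw : MeasurableSet {ω : Sample M A X | switch ω (n + 1) = true} :=
      measurableSet_eq_fun (measurable_fst.comp (measurable_seed (n + 1))) measurable_const
    have ha : Measurable fun ω : Sample M A X =>
        if n = 0 then ω.1
        else if switch ω (n + 1) = true then
          candidate ω (n + 1) (tieBreak ω n (argmaxSet (state ω m n).2))
        else (state ω m n).1 :=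
      Measurable.ite (MeasurableSet.const _) measurable_fst
        (Measurable.ite hsw hc (measurable_fst.comp ih))
    refine ha.prodMk (measurable_pi_lambda _ fun k => ?_)
    refine ((measurable_pi_apply k).comp (measurable_snd.comp ih)).add (Real.measurable_log.comp
      (measurable_coe_nnreal_real.comp ?_))
    have h : Measurable fun z : A × (A → X) => m.q k z.1 (z.2 z.1) :=
      measurable_from_prod_countable_right fun b =>
        (m.measurable_q k b).comp (measurable_pi_apply b)
    exact h.comp (ha.prodMk (measurable_snd.comp (measurable_snd.comp (measurable_snd.comp
      (measurable_seed (n + 1))))))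

theorem measurable_Z (k : Fin M) (n : ℕ) : Measurable fun ω : Sample M A X => Z ω m k n :=
  (measurable_pi_apply k).comp (measurable_snd.comp (measurable_state m n))

theorem measurable_theta (n : ℕ) : Measurable fun ω : Sample M A X => theta ω m n :=
  measurable_tieBreak_argmaxSet n (measurable_snd.comp (measurable_state m n))

theorem measurableSet_retires (L : ℝ) (n : ℕ) :
    MeasurableSet {ω : Sample M A X | Retires ω m L n} := by
  simp only [Retires, Set.ofPred_forall]
  have hZθ : Measurable fun ω : Sample M A X => Z ω m (theta ω m n) n := by
    have h : Measurable fun z : Fin M × (Fin M → ℝ) => z.2 z.1 :=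
      measurable_from_prod_countable_right fun b => measurable_pi_apply b
    exact h.comp ((measurable_theta m n).prodMk (measurable_snd.comp (measurable_state m n)))
  refine MeasurableSet.iInter fun j => ?_
  have h1 : MeasurableSet {ω : Sample M A X | j = theta ω m n} :=
    measurableSet_eq_fun measurable_const (measurable_theta m n)
  have h2 : MeasurableSet {ω : Sample M A X |
      Real.log (((M : ℝ) - 1) * L) ≤ Z ω m (theta ω m n) n - Z ω m j n} :=
    measurableSet_le measurable_const (hZθ.sub (measurable_Z m j n))
  convert h1.union h2 using 1
  ext ω
  simp only [Set.mem_union, Set.mem_ofPred_eq]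
  tauto

theorem measurableSet_lt_stopTime (L : ℝ) (n : ℕ) :
    MeasurableSet {ω : Sample M A X | (n : ℕ∞) < stopTime ω m L} := by
  simp only [lt_stopTime_iff, Set.ofPred_forall]
  exact MeasurableSet.iInter fun k => MeasurableSet.iInter fun _ =>
    (measurableSet_retires m L k).compl

end Trajectory

/-! ### Expected exponential weights and the probability of a wrong estimate -/

section Weights

variable {M : ℕ} [NeZero M] {A X : Type*} [MeasurableSpace X] (m : Model M A X)

/-- The exponential weight `exp (-s (z_i - z_j) - φ(a))` of an action and of log-likelihoods. -/
def weight (i j : Fin M) (s : ℝ) (φ : A → ℝ) (x : A × (Fin M → ℝ)) : ℝ≥0∞ :=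
  ENNReal.ofReal (Real.exp (-(s * (x.2 i - x.2 j)))) * ENNReal.ofReal (Real.exp (-φ x.1))

omit [NeZero M] in
theorem measurable_weight [MeasurableSpace A] [DiscreteMeasurableSpace A] (i j : Fin M) (s : ℝ)
    (φ : A → ℝ) : Measurable (weight i j s φ) := by
  have h1 : Measurable fun x : A × (Fin M → ℝ) =>
      ENNReal.ofReal (Real.exp (-(s * (x.2 i - x.2 j)))) := by fun_prop
  have h2 : Measurable fun x : A × (Fin M → ℝ) => ENNReal.ofReal (Real.exp (-φ x.1)) :=
    (Measurable.of_discrete (f := fun a => ENNReal.ofReal (Real.exp (-φ a)))).comp measurable_fst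
  exact h1.mul h2

/-- The factor by which one step multiplies the expected weight, up to the present value of `φ`. -/
def gain [Fintype A] (lam : Fin M → PMF A) (η : ℝ) (i j : Fin M) (s : ℝ) (φ : A → ℝ) (k : Fin M)
    (a : A) : ℝ :=
  η * ∑ b, (lam k b).toReal * (Real.exp (-φ b) * m.mgf i j s b) +
    (1 - η) * (Real.exp (-φ a) * m.mgf i j s a)

theorem sum_pmf_toReal [Fintype A] (p : PMF A) : ∑ a, (p a).toReal = 1 := by
  rw [← ENNReal.toReal_sum fun a _ => p.apply_ne_top a, ← tsum_fintype (L := .unconditional _),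
    p.tsum_coe, ENNReal.toReal_one]

variable {m}

omit [NeZero M] in
theorem lintegral_weight_addObs (hI : m.AssumptionI) (i j : Fin M) {s : ℝ} (hs : 0 ≤ s)
    (hs' : s ≤ 1) (φ : A → ℝ) (z : Fin M → ℝ) (a : A) :
    ∫⁻ x, weight i j s φ (a, fun k => z k + Real.log (m.q k a x)) ∂m.obsLaw i a =
      ENNReal.ofReal (Real.exp (-(s * (z i - z j)))) *
        ENNReal.ofReal (Real.exp (-φ a) * m.mgf i j s a) := by
  have h (x : X) : weight i j s φ (a, fun k => z k + Real.log (m.q k a x)) =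
      ENNReal.ofReal (Real.exp (-(s * (z i - z j)))) * ENNReal.ofReal (Real.exp (-φ a)) *
        ENNReal.ofReal (Real.exp (-(s * m.logRatio i j a x))) := by
    simp only [weight]
    rw [show -(s * (z i + Real.log (m.q i a x) - (z j + Real.log (m.q j a x)))) =
      -(s * (z i - z j)) + -(s * m.logRatio i j a x) by rw [Model.logRatio]; ring, Real.exp_add,
      ENNReal.ofReal_mul (Real.exp_pos _).le]
    ring
  simp only [h]
  have hm : Measurable fun x => ENNReal.ofReal (Real.exp (-(s * m.logRatio i j a x))) :=
    ((m.measurable_logRatio i j a).const_mul s).neg.exp.ennreal_ofReal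
  rw [lintegral_const_mul _ hm,
    hI.lintegral_exp_eq i j a hs hs', ENNReal.ofReal_mul (Real.exp_pos _).le, mul_assoc]

omit [NeZero M] in
theorem measurable_weight_addObs [MeasurableSpace A] [DiscreteMeasurableSpace A] (i j : Fin M)
    (s : ℝ) (φ : A → ℝ) (z : Fin M → ℝ) (a : A) :
    Measurable fun x => weight i j s φ (a, fun k => z k + Real.log (m.q k a x)) :=
  (measurable_weight i j s φ).comp (measurable_const.prodMk (measurable_pi_lambda _ fun k =>
    (Real.measurable_log.comp (measurable_coe_nnreal_real.comp
      (m.measurable_q k a))).const_add (z k)))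

variable [Fintype A] [MeasurableSpace A] [DiscreteMeasurableSpace A]
  (lam : Fin M → PMF A) (ν : PMF A) (η : unitInterval)

/-- Given the past, only the variables of time n + 1 are random, since θ(n) and A_n depend on
earlier ones. The factor exp(-φ) of the new action enters the gain, which leaves φ = 0 in the old
weight. -/
theorem lintegral_weight_succ (hI : m.AssumptionI) (i j : Fin M) {s : ℝ} (hs : 0 ≤ s)
    (hs' : s ≤ 1) (φ : A → ℝ) {n : ℕ} (hn : n ≠ 0) :
    ∫⁻ ω, weight i j s φ (state ω m (n + 1)) ∂law m lam ν η i =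
      ∫⁻ ω, weight i j s 0 (state ω m n) *
        ENNReal.ofReal (gain m lam η i j s φ (theta ω m n) (action ω m n)) ∂law m lam ν η i := by
  let F (ω : Sample M A X) (t : Seed M A X) : ℝ≥0∞ :=
    weight i j s φ (nextAction (theta ω m n) (state ω m n).1 t,
      addObs m (state ω m n).2 (nextAction (theta ω m n) (state ω m n).1 t) t)
  have hF (ω : Sample M A X) : weight i j s φ (state ω m (n + 1)) = F ω (ω.2 (n + 1)) := by
    rw [state_succ m ω hn]
  have hmF : Measurable fun ω => F ω (ω.2 (n + 1)) := by
    simp only [← hF]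
    exact (measurable_weight i j s φ).comp (measurable_state m (n + 1))
  simp only [hF]
  rw [lintegral_of_resample_eq m lam ν η i (n + 1) hmF fun ω t => by
    simp only [F, state_resample m ω (Nat.lt_succ_self n), theta_resample m ω (Nat.lt_succ_self n)]]
  refine lintegral_congr fun ω => ?_
  have h := lintegral_seedLaw m lam η i (theta ω m n) (state ω m n).1
    (G := fun b x => weight i j s φ (b, fun k => (state ω m n).2 k + Real.log (m.q k b x)))
    (measurable_weight_addObs i j s φ (state ω m n).2)
  refine Eq.trans h ?_
  simp only [lintegral_weight_addObs hI i j hs hs']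
  have hη : (0 : ℝ) ≤ 1 - η := sub_nonneg.2 η.2.2
  have hb (b : A) : 0 ≤ Real.exp (-φ b) * m.mgf i j s b :=
    mul_nonneg (Real.exp_pos _).le (Model.mgf_nonneg i j s b)
  have hl (b : A) : 0 ≤ (lam (theta ω m n) b).toReal * (Real.exp (-φ b) * m.mgf i j s b) :=
    mul_nonneg ENNReal.toReal_nonneg (hb b)
  rw [gain, ENNReal.ofReal_add (mul_nonneg η.2.1 (Finset.sum_nonneg fun b _ => hl b))
    (mul_nonneg hη (hb _)), ENNReal.ofReal_mul η.2.1, ENNReal.ofReal_mul hη,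
    ENNReal.ofReal_sum_of_nonneg fun b _ => hl b, mul_add, weight]
  simp only [Pi.zero_apply, neg_zero, Real.exp_zero, ENNReal.ofReal_one, mul_one,
    ENNReal.ofReal_mul ENNReal.toReal_nonneg, ENNReal.ofReal_toReal (PMF.apply_ne_top _ _),
    Finset.mul_sum, action]
  congr 1
  · exact Finset.sum_congr rfl fun b _ => by ring
  · ring

/-- The first action does not follow the update rule, so time 1 starts every recursion. Its law is
irrelevant because the moment generating function is at most 1 for every action. -/
theorem lintegral_weight_one (hI : m.AssumptionI) (i j : Fin M) {s : ℝ} (hs : 0 ≤ s)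
    (hs' : s ≤ 1) {φ : A → ℝ} (hφ : ∀ a, 0 ≤ φ a) :
    ∫⁻ ω, weight i j s φ (state ω m 1) ∂law m lam ν η i ≤ 1 := by
  let F (ω : Sample M A X) (t : Seed M A X) : ℝ≥0∞ :=
    weight i j s φ (ω.1, addObs m (fun _ => 0) ω.1 t)
  have hmF : Measurable fun ω => F ω (ω.2 1) :=
    (measurable_weight i j s φ).comp (measurable_state m 1)
  refine (lintegral_of_resample_eq m lam ν η i 1 hmF fun ω t => rfl).trans_le ?_
  refine (lintegral_mono (g := fun _ => 1) fun ω => ?_).trans (by simp)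
  refine (lintegral_seedLaw_obs m lam η i ω.1
    (measurable_weight_addObs i j s φ (fun _ => 0) ω.1)).trans_le ?_
  rw [lintegral_weight_addObs hI i j hs hs']
  simp only [sub_self, mul_zero, neg_zero, Real.exp_zero, ENNReal.ofReal_one, one_mul]
  exact ENNReal.ofReal_le_one.2 (mul_le_one₀ (Real.exp_le_one_iff.2 (neg_nonpos.2 (hφ _)))
    (Model.mgf_nonneg _ _ _ _) (hI.mgf_le_one i j _ hs hs'))

omit [NeZero M] [MeasurableSpace A] [DiscreteMeasurableSpace A] in
theorem gain_le_one (hI : m.AssumptionI) (i j : Fin M) {s : ℝ} (hs : 0 ≤ s)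
    (hs' : s ≤ 1) {φ : A → ℝ} (hφ : ∀ a, 0 ≤ φ a) (k : Fin M) (a : A) :
    gain m lam η i j s φ k a ≤ 1 := by
  have h (b : A) : Real.exp (-φ b) * m.mgf i j s b ≤ 1 :=
    mul_le_one₀ (Real.exp_le_one_iff.2 (neg_nonpos.2 (hφ _)))
      (Model.mgf_nonneg _ _ _ _) (hI.mgf_le_one i j _ hs hs')
  have h1 : ∑ b, (lam k b).toReal * (Real.exp (-φ b) * m.mgf i j s b) ≤ 1 := by
    rw [← sum_pmf_toReal (lam k)]
    exact Finset.sum_le_sum fun b _ => mul_le_of_le_one_right ENNReal.toReal_nonneg (h b)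
  have := mul_le_mul_of_nonneg_left h1 η.2.1
  have := mul_le_mul_of_nonneg_left (h a) (sub_nonneg.2 η.2.2)
  rw [gain]
  linarith

theorem lintegral_weight_le_pow (hI : m.AssumptionI) (i j : Fin M) {s : ℝ} (hs : 0 ≤ s)
    (hs' : s ≤ 1) {r : ℝ≥0∞}
    (hr : ∀ k a, ENNReal.ofReal (gain m lam η i j s 0 k a) ≤ r) (n : ℕ) :
    ∫⁻ ω, weight i j s 0 (state ω m (n + 1)) ∂law m lam ν η i ≤ r ^ n := by
  induction n with
  | zero =>
    simpa using lintegral_weight_one lam ν η hI i j hs hs' (φ := 0) fun _ => le_rfl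
  | succ n ih =>
    rw [lintegral_weight_succ lam ν η hI i j hs hs' 0 n.succ_ne_zero, pow_succ]
    calc _ ≤ ∫⁻ ω, weight i j s 0 (state ω m (n + 1)) * r ∂law m lam ν η i :=
          lintegral_mono fun ω => mul_le_mul_right (hr _ _) _
      _ = (∫⁻ ω, weight i j s 0 (state ω m (n + 1)) ∂law m lam ν η i) * r :=
          lintegral_mul_const _ ((measurable_weight i j s 0).comp (measurable_state m (n + 1)))
      _ ≤ _ := mul_le_mul_left ih r

theorem lintegral_weight_le_one (hI : m.AssumptionI) (i j : Fin M) {s : ℝ} (hs : 0 ≤ s)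
    (hs' : s ≤ 1) (n : ℕ) :
    ∫⁻ ω, weight i j s 0 (state ω m (n + 1)) ∂law m lam ν η i ≤ 1 := by
  simpa using lintegral_weight_le_pow lam ν η hI i j hs hs' (r := 1)
    (fun k a => ENNReal.ofReal_le_one.2 (gain_le_one lam η hI i j hs hs' (fun _ => le_rfl) k a)) n

omit [NeZero M] [MeasurableSpace A] [DiscreteMeasurableSpace A] in
open Classical in
/-- Some positive `r < 1` bounds the expected weights with `s = 1/2` geometrically. -/
theorem exists_gain_half_le (hI : m.AssumptionI) (hIIb : 0 < m.beta lam) (hη : (0 : ℝ) < η)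
    (i : Fin M) : ∃ r : ℝ, 0 < r ∧ r < 1 ∧ ∀ j, j ≠ i → ∀ k a,
      gain m lam η i j (1 / 2) 0 k a ≤ r := by
  have hlt (j : Fin M) (hj : j ≠ i) (k : Fin M) (a : A) : gain m lam η i j (1 / 2) 0 k a < 1 := by
    have hpos : 0 < ∑ b, if b ∈ m.discriminating i j then lam k b else 0 := by
      refine hIIb.trans_le ?_
      rw [Model.beta]
      exact (iInf_le _ i).trans ((iInf_le _ j).trans ((iInf_le _ hj.symm).trans (iInf_le _ k)))
    obtain ⟨b, -, hb⟩ := Finset.exists_ne_zero_of_sum_ne_zero hpos.ne'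
    have hbd : b ∈ m.discriminating i j := by
      by_contra hc; simp [hc] at hb
    have hbl : 0 < (lam k b).toReal := by
      rw [if_pos hbd] at hb
      exact ENNReal.toReal_pos hb ((lam k).apply_ne_top b)
    -- Strictness comes from b, a discriminating action with positive probability under λ_k. The
    -- present action need not discriminate and contributes at most 1 - η.
    have h1 : ∑ b, (lam k b).toReal * m.mgf i j (1 / 2) b < 1 := by
      refine (Finset.sum_lt_sum (fun b _ => mul_le_of_le_one_right ENNReal.toReal_nonneg
        (hI.mgf_le_one i j b (by norm_num) (by norm_num))) ⟨b, Finset.mem_univ b, ?_⟩).trans_eq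
        (sum_pmf_toReal (lam k))
      exact mul_lt_of_lt_one_right hbl (hI.mgf_half_lt_one hbd)
    have h2 := hI.mgf_le_one i j a (s := 1 / 2) (by norm_num) (by norm_num)
    have h3 := mul_lt_mul_of_pos_left h1 hη
    have h4 := mul_le_mul_of_nonneg_left h2 (sub_nonneg.2 η.2.2)
    simp only [gain, Pi.zero_apply, neg_zero, Real.exp_zero, one_mul]
    linarith
  -- Finitely many strict bounds hold uniformly for r close enough to 1 from below.
  have hev : ∀ᶠ r in nhdsWithin (1 : ℝ) (Set.Iio 1), ∀ j, j ≠ i → ∀ k a,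
      gain m lam η i j (1 / 2) 0 k a ≤ r := by
    refine eventually_all.2 fun j => eventually_all.2 fun hj => eventually_all.2 fun k =>
      eventually_all.2 fun a => ?_
    filter_upwards [nhdsWithin_le_nhds (lt_mem_nhds (hlt j hj k a))] with r hr
    exact hr.le
  obtain ⟨r, ⟨h1, h2⟩, h3⟩ := ((hev.and (nhdsWithin_le_nhds (lt_mem_nhds one_pos))).and
    self_mem_nhdsWithin).exists
  exact ⟨r, h2, h3, h1⟩

omit [DiscreteMeasurableSpace A] in
theorem theta_mem_argmax (i : Fin M) :
    ∀ᵐ ω ∂law m lam ν η i, ∀ n j, Z ω m j n ≤ Z ω m (theta ω m n) n := by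
  filter_upwards [ae_tieBreak_mem m lam ν η i] with ω h n j
  have := h n (argmaxSet (state ω m n).2)
  rw [argmaxSet, Finset.mem_filter] at this
  exact this.2 j

/-- If θ = j ≠ i then Z_j ≥ Z_i, so the weight for j is at least 1; Markov's inequality and a union
bound over j finish. The exponent is n at time n + 1 because the first step need not contract. -/
theorem measure_theta_ne_le (hI : m.AssumptionI) (i : Fin M) {r : ℝ}
    (hr : ∀ j, j ≠ i → ∀ k a, gain m lam η i j (1 / 2) 0 k a ≤ r) (n : ℕ) :
    law m lam ν η i {ω | theta ω m (n + 1) ≠ i} ≤ M * ENNReal.ofReal r ^ n := by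
  have hsub : ({ω | theta ω m (n + 1) ≠ i} : Set (Sample M A X)) ≤ᵐ[law m lam ν η i]
      ⋃ j ∈ Finset.univ.erase i, {ω | 1 ≤ weight i j (1 / 2) 0 (state ω m (n + 1))} := by
    filter_upwards [theta_mem_argmax lam ν η i] with ω h hne
    refine Set.mem_biUnion (x := theta ω m (n + 1)) (Finset.mem_erase.2 ⟨hne, Finset.mem_univ _⟩) ?_
    have h1 := h (n + 1) i
    simp only [Z] at h1
    simp only [weight, Set.mem_ofPred_eq, Pi.zero_apply, neg_zero, Real.exp_zero,
      ENNReal.ofReal_one, mul_one, ENNReal.one_le_ofReal, Real.one_le_exp_iff]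
    linarith
  refine (measure_mono_ae hsub).trans ((measure_biUnion_finset_le _ _).trans ?_)
  have hj : ∀ j ∈ Finset.univ.erase i, law m lam ν η i
      {ω | 1 ≤ weight i j (1 / 2) 0 (state ω m (n + 1))} ≤ ENNReal.ofReal r ^ n := by
    intro j hj
    have h1 := mul_meas_ge_le_lintegral (μ := law m lam ν η i)
      ((measurable_weight i j (1 / 2) 0).comp (measurable_state m (n + 1))) 1
    rw [one_mul] at h1
    exact h1.trans (lintegral_weight_le_pow lam ν η hI i j (by norm_num) (by norm_num)
      (fun k a => ENNReal.ofReal_le_ofReal (hr j (Finset.ne_of_mem_erase hj) k a)) n)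
  refine (Finset.sum_le_sum hj).trans ?_
  rw [Finset.sum_const, nsmul_eq_mul]
  gcongr
  exact (Finset.card_le_univ _).trans (by simp)

end Weights

/-! ### The drift corrected for sluggish switching -/

section Drift

variable {M : ℕ} {A X : Type*} [MeasurableSpace X] {m : Model M A X} [Fintype A]
  (lam : Fin M → PMF A) (η : unitInterval)

/-- The corrector, which turns the expected increment of the log-likelihood ratio, which depends on
the present action, into its stationary value. -/
def corrector (m : Model M A X) (η : ℝ) (i j : Fin M) (s : ℝ) (a : A) : ℝ :=
  s * ((1 - η) / η * (m.relEnt i j a).toReal)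

omit [Fintype A] in
theorem corrector_nonneg (m : Model M A X) (i j : Fin M) {s : ℝ} (hs : 0 ≤ s) (a : A) :
    0 ≤ corrector m η i j s a :=
  mul_nonneg hs (mul_nonneg (div_nonneg (sub_nonneg.2 η.2.2) η.2.1) ENNReal.toReal_nonneg)

theorem corrector_le (m : Model M A X) (i j : Fin M) {s : ℝ} (hs : 0 ≤ s) (a : A) :
    corrector m η i j s a ≤ s * ((1 - η) / η * ∑ b, (m.relEnt i j b).toReal) := by
  have h1 : (m.relEnt i j a).toReal ≤ ∑ b, (m.relEnt i j b).toReal :=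
    Finset.single_le_sum (f := fun b => (m.relEnt i j b).toReal)
      (fun _ _ => ENNReal.toReal_nonneg) (Finset.mem_univ a)
  have h2 : (0 : ℝ) ≤ (1 - η) / η := div_nonneg (sub_nonneg.2 η.2.2) η.2.1
  unfold corrector
  gcongr

/-- One step of a chain that stays at `a` with probability `1 - η` and moves to a `p`-distributed
point otherwise, and multiplies a weight by about `exp (-s d)` on each visit. With the corrector
`κ d`, where `η κ = 1 - η`, the weight decays at the stationary rate, to first order in `s`. -/
theorem eventually_corrected_step_le {A : Type*} [Fintype A] {p d V : A → ℝ} {g : ℝ → A → ℝ}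
    {η κ D ε : ℝ} (hp0 : ∀ a, 0 ≤ p a) (hp1 : ∑ a, p a = 1) (hd0 : ∀ a, 0 ≤ d a)
    (hV0 : ∀ a, 0 ≤ V a) (hη0 : 0 ≤ η) (hη1 : η ≤ 1) (hκ0 : 0 ≤ κ) (hηκ : η * κ = 1 - η)
    (hg : ∀ s, 0 ≤ s → s ≤ 1 / 2 → ∀ a, g s a ≤ 1 - s * d a + s ^ 2 * V a)
    (hD : D ≤ ∑ a, p a * d a) (hε : 0 < ε) :
    ∀ᶠ s in nhdsWithin (0 : ℝ) (Set.Ioi 0), ∀ a,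
      η * ∑ b, p b * (Real.exp (-(s * (κ * d b))) * g s b) +
          (1 - η) * (Real.exp (-(s * (κ * d a))) * g s a) ≤
        Real.exp (-(s * (κ * d a))) * Real.exp (-(s * (D - ε))) := by
  obtain ⟨C, hC⟩ : ∃ C, C = ∑ a, V a := ⟨_, rfl⟩
  have hVC (a : A) : V a ≤ C :=
    hC ▸ Finset.single_le_sum (fun b _ => hV0 b) (Finset.mem_univ a)
  have hC0 : 0 ≤ C := hC ▸ Finset.sum_nonneg fun b _ => hV0 b
  obtain ⟨B, hB⟩ : ∃ B, B = ∑ a, d a := ⟨_, rfl⟩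
  have hdB (a : A) : d a ≤ B :=
    hB ▸ Finset.single_le_sum (fun b _ => hd0 b) (Finset.mem_univ a)
  have hB0 : 0 ≤ B := hB ▸ Finset.sum_nonneg fun b _ => hd0 b
  -- Q bounds |t| / s for the exponent t below. K collects the errors of order s²: C from the
  -- second-order terms of g, and Q² from expanding exp t.
  obtain ⟨Q, hQ⟩ : ∃ Q, Q = κ * B + B + C := ⟨_, rfl⟩
  obtain ⟨K, hK⟩ : ∃ K, K = C + Q ^ 2 := ⟨_, rfl⟩
  have hlim (c : ℝ) : Tendsto (fun s : ℝ => s * c) (nhdsWithin 0 (Set.Ioi 0)) (nhds 0) := by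
    have hc : Continuous fun s : ℝ => s * c := by fun_prop
    exact (hc.tendsto' 0 0 (zero_mul c)).mono_left nhdsWithin_le_nhds
  filter_upwards [(hlim Q).eventually (gt_mem_nhds one_pos), (hlim K).eventually (gt_mem_nhds hε),
    self_mem_nhdsWithin, nhdsWithin_le_nhds (gt_mem_nhds (show (0 : ℝ) < 1 / 2 by norm_num))]
    with s hs1 hsK hs0 hs2 a
  replace hs0 : 0 < s := hs0
  -- The corrector factor at the present action a is pulled out, so every possible next action b is
  -- compared with it to first order in s.
  have key (b : A) : Real.exp (-(s * (κ * d b))) * g s b ≤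
      Real.exp (-(s * (κ * d a))) *
        (1 + s * κ * d a - s * (κ + 1) * d b + s ^ 2 * K) := by
    have h1 : g s b ≤ Real.exp (-(s * d b) + s ^ 2 * C) := by
      refine (hg s hs0.le hs2.le b).trans ?_
      have h2 := Real.add_one_le_exp (-(s * d b) + s ^ 2 * C)
      have h3 : s ^ 2 * V b ≤ s ^ 2 * C := mul_le_mul_of_nonneg_left (hVC b) (sq_nonneg s)
      linarith
    obtain ⟨t, ht⟩ : ∃ t, t = s * κ * d a - s * (κ + 1) * d b + s ^ 2 * C := ⟨_, rfl⟩
    have h2 : Real.exp (-(s * (κ * d b))) * Real.exp (-(s * d b) + s ^ 2 * C) =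
        Real.exp (-(s * (κ * d a))) * Real.exp t := by
      rw [← Real.exp_add, ← Real.exp_add, ht]
      congr 1
      ring
    have hab : |t| ≤ s * Q := by
      have e1 : s * κ * d a ≤ s * κ * B := mul_le_mul_of_nonneg_left (hdB a) (by positivity)
      have e2 : s * (κ + 1) * d b ≤ s * (κ + 1) * B :=
        mul_le_mul_of_nonneg_left (hdB b) (by positivity)
      have e3 : s ^ 2 * C ≤ s * C := mul_le_mul_of_nonneg_right (by nlinarith) hC0
      have e4 : 0 ≤ s * κ * d a := mul_nonneg (by positivity) (hd0 a)
      have e5 : 0 ≤ s * (κ + 1) * d b := mul_nonneg (by positivity) (hd0 b)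
      have e6 : 0 ≤ s ^ 2 * C := by positivity
      have e7 : 0 ≤ s * B := by positivity
      have e8 : 0 ≤ s * C := by positivity
      rw [abs_le, ht, hQ]
      constructor <;> linarith
    have h3 := (abs_le.1 (Real.abs_exp_sub_one_sub_id_le (hab.trans hs1.le))).2
    have h4 : t ^ 2 ≤ (s * Q) ^ 2 := sq_le_sq' (abs_le.1 hab).1 (abs_le.1 hab).2
    refine (mul_le_mul_of_nonneg_left h1 (Real.exp_pos _).le).trans (h2.trans_le ?_)
    refine mul_le_mul_of_nonneg_left ?_ (Real.exp_pos _).le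
    rw [hK]
    linarith
  obtain ⟨E, hE⟩ : ∃ E, E = Real.exp (-(s * (κ * d a))) := ⟨_, rfl⟩
  have hE0 : 0 < E := hE ▸ Real.exp_pos _
  rw [← hE] at key ⊢
  have hsum : ∑ b, p b * (Real.exp (-(s * (κ * d b))) * g s b) ≤
      E * (1 + s * κ * d a - s * (κ + 1) * (∑ b, p b * d b) + s ^ 2 * K) := by
    refine (Finset.sum_le_sum fun b _ => mul_le_mul_of_nonneg_left (key b) (hp0 b)).trans_eq ?_
    have h (b : A) : p b * (E * (1 + s * κ * d a - s * (κ + 1) * d b + s ^ 2 * K)) =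
        p b * (E * (1 + s * κ * d a + s ^ 2 * K)) - p b * d b * (E * (s * (κ + 1))) := by ring
    simp only [h]
    rw [Finset.sum_sub_distrib, ← Finset.sum_mul, ← Finset.sum_mul, hp1]
    ring
  have h0 := key a
  rw [← hE] at h0
  have h1 := mul_le_mul_of_nonneg_left hsum hη0
  have h2 := mul_le_mul_of_nonneg_left h0 (sub_nonneg.2 hη1)
  obtain ⟨S, hS⟩ : ∃ S, S = ∑ b, p b * d b := ⟨_, rfl⟩
  rw [← hS] at h1 hD
  -- The cancellation: d a has the coefficient ηκ - (1 - η) = 0, and S has -η(κ + 1) = -1.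
  have h3 : η * (E * (1 + s * κ * d a - s * (κ + 1) * S + s ^ 2 * K)) +
      (1 - η) * (E * (1 + s * κ * d a - s * (κ + 1) * d a + s ^ 2 * K)) =
      E * (1 + s ^ 2 * K - s * S) := by
    linear_combination (E * s * (d a - S)) * hηκ
  refine (add_le_add h1 h2).trans (h3.trans_le (mul_le_mul_of_nonneg_left ?_ hE0.le))
  have h4 := Real.add_one_le_exp (-(s * (D - ε)))
  have h5 := mul_le_mul_of_nonneg_left hD hs0.le
  have h6 := mul_le_mul_of_nonneg_left hsK.le hs0.le
  linarith

theorem gain_corrector_le (hI : m.AssumptionI) (hη : (0 : ℝ) < η) (i j : Fin M) {D ε : ℝ}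
    (hD : D ≤ ∑ b, (lam i b).toReal * (m.relEnt i j b).toReal) (hε : 0 < ε) :
    ∀ᶠ s in nhdsWithin (0 : ℝ) (Set.Ioi 0), ∀ a,
      gain m lam η i j s (corrector m η i j s) i a ≤
        Real.exp (-corrector m η i j s a) * Real.exp (-(s * (D - ε))) :=
  eventually_corrected_step_le (fun _ => ENNReal.toReal_nonneg) (sum_pmf_toReal (lam i))
    (fun _ => ENNReal.toReal_nonneg)
    (fun _ => add_nonneg (integral_nonneg fun _ => sq_nonneg _) (by norm_num)) η.2.1 η.2.2
    (div_nonneg (sub_nonneg.2 η.2.2) η.2.1) (mul_div_cancel₀ _ hη.ne')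
    (fun _ hs hs' a => hI.mgf_le i j a hs hs') hD hε

end Drift

/-! ### Exponential tails of the log-likelihood ratios -/

section Tail

variable {M : ℕ} [NeZero M] {A X : Type*} [MeasurableSpace X] {m : Model M A X}
  [Fintype A] [MeasurableSpace A] [DiscreteMeasurableSpace A]
  (lam : Fin M → PMF A) (ν : PMF A) (η : unitInterval)

/-- A substitute for Cauchy–Schwarz, with t free to balance the two terms. -/
theorem le_mul_sq_add_inv (a t : ℝ≥0∞) : a ≤ t * a ^ 2 + t⁻¹ := by
  rcases le_total 1 (t * a) with h | h
  · calc a = 1 * a := (one_mul a).symm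
      _ ≤ t * a * a := mul_le_mul_left h a
      _ = t * a ^ 2 := by ring
      _ ≤ _ := le_self_add
  · exact (ENNReal.le_inv_iff_mul_le.2 (by rwa [mul_comm])).trans le_add_self

/-- The squared weight is the weight at 2s ≤ 1, whose mean is at most 1, while the event has
probability at most M q^(2n). Taking t = q^n balances the two terms. -/
theorem lintegral_weight_indicator_le (hI : m.AssumptionI) (i j : Fin M) {s q : ℝ} (hs : 0 ≤ s)
    (hs' : s ≤ 1 / 2) (hq : 0 < q)
    (hr : ∀ j, j ≠ i → ∀ k a, gain m lam η i j (1 / 2) 0 k a ≤ q ^ 2) (n : ℕ) :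
    ∫⁻ ω in {ω | theta ω m (n + 1) ≠ i}, weight i j s 0 (state ω m (n + 1)) ∂law m lam ν η i ≤
      ENNReal.ofReal ((1 + M) * q ^ n) := by
  set t : ℝ≥0∞ := ENNReal.ofReal (q ^ n) with ht
  have ht0 : t ≠ 0 := by simpa [ht] using pow_pos hq n
  have hsq (x : A × (Fin M → ℝ)) : weight i j s 0 x ^ 2 = weight i j (2 * s) 0 x := by
    simp only [weight, Pi.zero_apply, neg_zero, Real.exp_zero, ENNReal.ofReal_one, mul_one]
    rw [← ENNReal.ofReal_pow (Real.exp_pos _).le, ← Real.exp_nat_mul]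
    congr 2
    push_cast
    ring
  have hm : Measurable fun ω : Sample M A X => weight i j (2 * s) 0 (state ω m (n + 1)) :=
    (measurable_weight i j (2 * s) 0).comp (measurable_state m (n + 1))
  calc _ ≤ ∫⁻ ω in {ω | theta ω m (n + 1) ≠ i},
        (t * weight i j (2 * s) 0 (state ω m (n + 1)) + t⁻¹) ∂law m lam ν η i :=
        lintegral_mono fun ω => by rw [← hsq]; exact le_mul_sq_add_inv _ _
    _ = (∫⁻ ω in {ω | theta ω m (n + 1) ≠ i},
        t * weight i j (2 * s) 0 (state ω m (n + 1)) ∂law m lam ν η i) +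
          t⁻¹ * law m lam ν η i {ω | theta ω m (n + 1) ≠ i} := by
        rw [lintegral_add_right _ measurable_const, setLIntegral_const]
    _ ≤ t * 1 + t⁻¹ * (M * ENNReal.ofReal (q ^ 2) ^ n) := by
        refine add_le_add ?_ (mul_le_mul_right (measure_theta_ne_le lam ν η hI i hr n) _)
        refine (setLIntegral_le_lintegral _ _).trans ?_
        rw [lintegral_const_mul _ hm]
        exact mul_le_mul_right (lintegral_weight_le_one lam ν η hI i j (by linarith)
          (by linarith) n) _
    _ = ENNReal.ofReal ((1 + M) * q ^ n) := by
        have h2 : ENNReal.ofReal (q ^ 2) ^ n = t * t := by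
          rw [← ENNReal.ofReal_pow (sq_nonneg q), ht, ← ENNReal.ofReal_mul (pow_nonneg hq.le n)]
          congr 1; ring
        rw [h2, show t⁻¹ * (M * (t * t)) = M * (t⁻¹ * t * t) by ring,
          ENNReal.inv_mul_cancel ht0 ENNReal.ofReal_ne_top, one_mul, mul_one,
          ENNReal.ofReal_mul (by positivity), ENNReal.ofReal_add zero_le_one (by positivity),
          ENNReal.ofReal_one, ENNReal.ofReal_natCast, add_mul, one_mul]

/-- Where θ = i, the factor exp(-φ) in the bound on the gain restores the corrected weight, times ρ.
Elsewhere the gain is merely at most 1, and the preceding estimate pays for it. -/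
theorem lintegral_weight_corrector_succ (hI : m.AssumptionI) (i j : Fin M) {s q ρ : ℝ}
    (hs : 0 ≤ s) (hs' : s ≤ 1 / 2) (hq : 0 < q)
    (hr : ∀ j, j ≠ i → ∀ k a, gain m lam η i j (1 / 2) 0 k a ≤ q ^ 2)
    (hρ : ∀ a, gain m lam η i j s (corrector m η i j s) i a ≤
      Real.exp (-corrector m η i j s a) * ρ) (n : ℕ) :
    ∫⁻ ω, weight i j s (corrector m η i j s) (state ω m (n + 1 + 1)) ∂law m lam ν η i ≤
      (∫⁻ ω, weight i j s (corrector m η i j s) (state ω m (n + 1)) ∂law m lam ν η i) *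
        ENNReal.ofReal ρ + ENNReal.ofReal ((1 + M) * q ^ n) := by
  have hmθ : MeasurableSet {ω : Sample M A X | theta ω m (n + 1) ≠ i} :=
    (measurable_theta m (n + 1)) (MeasurableSet.singleton i).compl
  have hmw : Measurable fun ω : Sample M A X =>
      weight i j s (corrector m η i j s) (state ω m (n + 1)) :=
    (measurable_weight i j s _).comp (measurable_state m (n + 1))
  rw [lintegral_weight_succ lam ν η hI i j hs (by linarith) _ n.succ_ne_zero]
  calc _ ≤ ∫⁻ ω, (weight i j s (corrector m η i j s) (state ω m (n + 1)) * ENNReal.ofReal ρ +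
        {ω | theta ω m (n + 1) ≠ i}.indicator
          (fun ω => weight i j s 0 (state ω m (n + 1))) ω) ∂law m lam ν η i := by
        refine lintegral_mono fun ω => ?_
        by_cases h : theta ω m (n + 1) = i
        · refine le_add_right ?_
          rw [h]
          refine (mul_le_mul_right (ENNReal.ofReal_le_ofReal (hρ _)) _).trans_eq ?_
          rw [ENNReal.ofReal_mul (Real.exp_pos _).le, weight, weight, action]
          simp [mul_assoc]
        · refine le_add_left ?_
          rw [Set.indicator_of_mem (by exact h)]
          exact mul_le_of_le_one_right' (ENNReal.ofReal_le_one.2 (gain_le_one lam η hI i j hs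
            (by linarith) (corrector_nonneg η m i j hs) _ _))
    _ = _ := by
        rw [lintegral_add_left (hmw.mul_const _), lintegral_mul_const _ hmw,
          lintegral_indicator hmθ]
    _ ≤ _ := by
        gcongr
        exact lintegral_weight_indicator_le lam ν η hI i j hs hs' hq hr n

theorem lintegral_weight_corrector_le (hI : m.AssumptionI) (i j : Fin M) {s q ρ ρ' : ℝ}
    (hs : 0 ≤ s) (hs' : s ≤ 1 / 2) (hq : 0 < q)
    (hr : ∀ j, j ≠ i → ∀ k a, gain m lam η i j (1 / 2) 0 k a ≤ q ^ 2)
    (hρ : ∀ a, gain m lam η i j s (corrector m η i j s) i a ≤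
      Real.exp (-corrector m η i j s a) * ρ) (hρ0 : 0 ≤ ρ) (hρρ' : ρ < ρ') (hqρ' : q ≤ ρ') (n : ℕ) :
    ∫⁻ ω, weight i j s (corrector m η i j s) (state ω m (n + 1)) ∂law m lam ν η i ≤
      ENNReal.ofReal ((1 + (1 + M) / (ρ' - ρ)) * ρ' ^ n) := by
  have hpos : 0 < ρ' - ρ := sub_pos.2 hρρ'
  set C : ℝ := 1 + (1 + M) / (ρ' - ρ) with hC
  have hM : (0 : ℝ) ≤ 1 + M := by positivity
  have hC1 : 1 ≤ C := le_add_of_nonneg_right (div_nonneg hM hpos.le)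
  -- C is chosen so that Cρ + (1 + M) ≤ Cρ'; this closes the induction because q ≤ ρ'.
  have hCM : 1 + M ≤ C * (ρ' - ρ) := by
    rw [hC, add_mul, div_mul_cancel₀ _ hpos.ne']
    linarith
  induction n with
  | zero =>
    refine (lintegral_weight_one lam ν η hI i j hs (by linarith)
      (corrector_nonneg η m i j hs)).trans ?_
    rw [pow_zero, mul_one]
    exact ENNReal.one_le_ofReal.2 hC1
  | succ n ih =>
    have hρ'0 : 0 ≤ ρ' := hρ0.trans hρρ'.le
    have hp : 0 ≤ ρ' ^ n := pow_nonneg hρ'0 n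
    refine (lintegral_weight_corrector_succ lam ν η hI i j hs hs' hq hr hρ n).trans ?_
    refine (add_le_add_left (mul_le_mul_left ih _) _).trans ?_
    rw [← ENNReal.ofReal_mul (by positivity), ← ENNReal.ofReal_add (by positivity) (by positivity)]
    refine ENNReal.ofReal_le_ofReal ?_
    have h1 : (1 + M) * q ^ n ≤ (1 + M) * ρ' ^ n :=
      mul_le_mul_of_nonneg_left (pow_le_pow_left₀ hq.le hqρ' n) hM
    have h2 := mul_le_mul_of_nonneg_right hCM hp
    rw [pow_succ]
    linarith

/-- The log-likelihood ratio of the true hypothesis and another one grows at least at the rate `D`,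
up to events of exponentially small probability. -/
theorem measure_logRatio_le (hI : m.AssumptionI) (hIIb : 0 < m.beta lam) (hη : (0 : ℝ) < η)
    (i j : Fin M) {D ε : ℝ}
    (hD : D ≤ ∑ b, (lam i b).toReal * (m.relEnt i j b).toReal) (hε : 0 < ε) :
    ∃ C r : ℝ, 0 ≤ C ∧ 0 ≤ r ∧ r < 1 ∧ ∀ n : ℕ, law m lam ν η i
      {ω | Z ω m i (n + 1) - Z ω m j (n + 1) ≤ (n + 1) * (D - ε)} ≤ ENNReal.ofReal (C * r ^ n) := by
  obtain ⟨r, hr0, hr1, hr⟩ := exists_gain_half_le lam η hI hIIb hη i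
  set q := √r with hq
  have hq0 : 0 < q := Real.sqrt_pos.2 hr0
  have hq1 : q < 1 := by rw [hq, Real.sqrt_lt' one_pos]; simpa using hr1
  have hqr : q ^ 2 = r := Real.sq_sqrt hr0.le
  -- The loss ε is spent in three parts: the second-order error in the gain, the slack between ρ and
  -- ρ', and the final geometric ratio exp(-sε/3).
  have hε3 : 0 < ε / 3 := by positivity
  have hlim : Tendsto (fun s : ℝ => Real.exp (-(s * (D - 2 * (ε / 3)))))
      (nhdsWithin 0 (Set.Ioi 0)) (nhds 1) := by
    have hc : Continuous fun s : ℝ => Real.exp (-(s * (D - 2 * (ε / 3)))) := by fun_prop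
    exact (hc.tendsto' 0 1 (by simp)).mono_left nhdsWithin_le_nhds
  -- As s decreases to 0, ρ' tends to 1 and exceeds q, so wrong estimates decay fast enough not to
  -- affect the rate.
  obtain ⟨s, ⟨⟨hg, hqs⟩, hs2⟩, hs0⟩ := (((gain_corrector_le lam η hI hη i j hD hε3).and
    (hlim.eventually (lt_mem_nhds hq1))).and (nhdsWithin_le_nhds
      (gt_mem_nhds (show (0 : ℝ) < 1 / 2 by norm_num)))).and self_mem_nhdsWithin |>.exists
  have hs0 : 0 < s := hs0
  set ρ := Real.exp (-(s * (D - ε / 3))) with hρ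
  set ρ' := Real.exp (-(s * (D - 2 * (ε / 3)))) with hρ'
  have hρρ' : ρ < ρ' := Real.exp_lt_exp.2 (by nlinarith)
  have hw := lintegral_weight_corrector_le lam ν η hI i j hs0.le hs2.le hq0
    (fun j hj k a => (hr j hj k a).trans_eq hqr.symm) hg (Real.exp_pos _).le hρρ' hqs.le
  set C := 1 + (1 + M) / (ρ' - ρ) with hC
  have hC0 : 0 ≤ C := add_nonneg zero_le_one (div_nonneg (by positivity) (sub_pos.2 hρρ').le)
  set c := s * ((1 - η) / η * ∑ b, (m.relEnt i j b).toReal) with hc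
  refine ⟨C * Real.exp (c + s * (D - ε)), Real.exp (-(s * (ε / 3))), by positivity,
    (Real.exp_pos _).le, by rw [Real.exp_lt_one_iff]; nlinarith, fun n => ?_⟩
  -- On the event, e bounds the weight from below; c is the largest possible cost of the corrector.
  set e := Real.exp (-(s * ((n + 1) * (D - ε))) - c) with he
  have he0 : 0 < e := Real.exp_pos _
  have hsub : {ω : Sample M A X | Z ω m i (n + 1) - Z ω m j (n + 1) ≤ (n + 1) * (D - ε)} ⊆
      {ω | ENNReal.ofReal e ≤ weight i j s (corrector m η i j s) (state ω m (n + 1))} := by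
    intro ω hω
    have hω : (state ω m (n + 1)).2 i - (state ω m (n + 1)).2 j ≤ (n + 1) * (D - ε) := hω
    have h1 := corrector_le η m i j hs0.le (state ω m (n + 1)).1
    have h2 := mul_le_mul_of_nonneg_left hω hs0.le
    show ENNReal.ofReal e ≤ weight i j s (corrector m η i j s) (state ω m (n + 1))
    rw [weight, ← ENNReal.ofReal_mul (Real.exp_pos _).le, ← Real.exp_add]
    exact ENNReal.ofReal_le_ofReal (Real.exp_le_exp.2 (by linarith))
  have h1 := mul_meas_ge_le_lintegral (μ := law m lam ν η i)
    ((measurable_weight i j s (corrector m η i j s)).comp (measurable_state m (n + 1)))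
    (ENNReal.ofReal e)
  have h2 := (h1.trans (hw n))
  have h3 : C * ρ' ^ n = e * (C * Real.exp (c + s * (D - ε)) * Real.exp (-(s * (ε / 3))) ^ n) := by
    rw [mul_assoc C, mul_left_comm, he, hρ', ← Real.exp_nat_mul, ← Real.exp_nat_mul,
      ← Real.exp_add, ← Real.exp_add]
    congr 2
    ring
  rw [h3, ENNReal.ofReal_mul he0.le] at h2
  exact (measure_mono hsub).trans ((ENNReal.mul_le_mul_iff_right (by simpa using he0)
    ENNReal.ofReal_ne_top).1 h2)

end Tail

/-! ### Finiteness and positivity of D_i -/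

section Divergence

variable {M : ℕ} {A X : Type*} [MeasurableSpace X] {m : Model M A X} [Fintype A]
  {lam : Fin M → PMF A}

theorem D_eq_guard (hlam : ∀ k, IsMaxOn (m.guard k) Set.univ (lam k)) (i : Fin M) :
    m.D i = m.guard i (lam i) :=
  le_antisymm (iSup_le fun p => hlam i (Set.mem_univ p)) (le_iSup (m.guard i) (lam i))

theorem D_le_sum (hlam : ∀ k, IsMaxOn (m.guard k) Set.univ (lam k)) {i j : Fin M} (hj : j ≠ i) :
    m.D i ≤ ∑ a, lam i a * m.relEnt i j a := by
  rw [D_eq_guard hlam]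
  exact iInf₂_le j hj

theorem sum_relEnt_ne_top (hI : m.AssumptionI) (i j : Fin M) (p : PMF A) :
    ∑ a, p a * m.relEnt i j a ≠ ⊤ :=
  ENNReal.sum_ne_top.2 fun a _ => ENNReal.mul_ne_top (p.apply_ne_top a) (hI.relEnt_ne_top i j a)

theorem D_ne_top (hM : 2 ≤ M) (hI : m.AssumptionI)
    (hlam : ∀ k, IsMaxOn (m.guard k) Set.univ (lam k)) (i : Fin M) : m.D i ≠ ⊤ := by
  have : Nontrivial (Fin M) := Fin.nontrivial_iff_two_le.2 hM
  obtain ⟨j, hj⟩ := exists_ne i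
  exact ne_top_of_le_ne_top (sum_relEnt_ne_top hI i j (lam i)) (D_le_sum hlam hj)

theorem toReal_D_le_sum (hI : m.AssumptionI)
    (hlam : ∀ k, IsMaxOn (m.guard k) Set.univ (lam k)) {i j : Fin M} (hj : j ≠ i) :
    (m.D i).toReal ≤ ∑ a, (lam i a).toReal * (m.relEnt i j a).toReal := by
  have h := ENNReal.toReal_mono (sum_relEnt_ne_top hI i j (lam i)) (D_le_sum hlam hj)
  rw [ENNReal.toReal_sum fun a _ =>
    ENNReal.mul_ne_top ((lam i).apply_ne_top a) (hI.relEnt_ne_top i j a)] at h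
  simpa only [ENNReal.toReal_mul] using h

open Classical in
theorem D_pos (hIIb : 0 < m.beta lam)
    (hlam : ∀ k, IsMaxOn (m.guard k) Set.univ (lam k)) (i : Fin M) : 0 < m.D i := by
  have hpos (j : Fin M) (hj : j ≠ i) : 0 < ∑ a, lam i a * m.relEnt i j a := by
    have h : 0 < ∑ b, if b ∈ m.discriminating i j then lam i b else 0 := by
      refine hIIb.trans_le ?_
      rw [Model.beta]
      exact (iInf_le _ i).trans ((iInf_le _ j).trans ((iInf_le _ hj.symm).trans (iInf_le _ i)))
    obtain ⟨b, -, hb⟩ := Finset.exists_ne_zero_of_sum_ne_zero h.ne'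
    have hbd : b ∈ m.discriminating i j := by
      by_contra hc; simp [hc] at hb
    rw [if_pos hbd] at hb
    exact (ENNReal.mul_pos hb (ne_of_gt hbd)).trans_le
      (Finset.single_le_sum (f := fun a => lam i a * m.relEnt i j a) (fun _ _ => zero_le)
        (Finset.mem_univ b))
  have : Nonempty (Fin M) := ⟨i⟩
  -- The value 1 at j = i is a positive filler, so that a minimum over all of `Fin M` can be taken.
  let f (j : Fin M) : ℝ≥0∞ := if j ≠ i then ∑ a, lam i a * m.relEnt i j a else 1
  obtain ⟨j₀, hj₀⟩ := Finite.exists_min f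
  have hf : 0 < f j₀ := by
    by_cases h : j₀ = i
    · simp [f, h]
    · simpa only [f, if_pos (show j₀ ≠ i from h)] using hpos j₀ h
  rw [D_eq_guard hlam]
  refine hf.trans_le (le_iInf₂ fun j hj => (hj₀ j).trans_eq ?_)
  simp only [f, if_pos hj]

end Divergence

/-! ### From the tail estimates to the expected cost -/

section Cost

variable {M : ℕ} [NeZero M] {A X : Type*} [MeasurableSpace X] {m : Model M A X}
  [Fintype A] [MeasurableSpace A] [DiscreteMeasurableSpace A]
  (lam : Fin M → PMF A) (ν : PMF A) (η : unitInterval)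

open Classical in
theorem toENNReal_le_tsum (t : ℕ∞) :
    (t : ℝ≥0∞) ≤ ∑' n : ℕ, if (n : ℕ∞) < t then (1 : ℝ≥0∞) else 0 := by
  induction t using ENat.recTopCoe with
  | top => simp
  | coe N =>
    refine le_trans ?_ (ENNReal.sum_le_tsum (Finset.range N))
    rw [Finset.sum_congr rfl fun n hn => if_pos (by exact_mod_cast Finset.mem_range.1 hn)]
    simp

omit [NeZero M] [MeasurableSpace X] [MeasurableSpace A] [DiscreteMeasurableSpace A] in
theorem le_gMax (g : A → A → ℝ≥0) (a b : A) : g a b ≤ gMax g :=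
  Finset.le_sup (f := fun p : A × A => g p.1 p.2) (Finset.mem_univ (a, b))

open Classical in
omit [MeasurableSpace A] [DiscreteMeasurableSpace A] in
/-- A switching cost is paid only where the switching indicator is `1`. -/
theorem totalCost_le (g : A → A → ℝ≥0) (hg : ∀ a, g a a = 0) (L : ℝ) (ω : Sample M A X) :
    totalCost ω m g L ≤ ∑' n : ℕ, ((if (n : ℕ∞) < stopTime ω m L then (1 : ℝ≥0∞) else 0) +
      gMax g * ((if (n : ℕ∞) < stopTime ω m L then (1 : ℝ≥0∞) else 0) *
        (if (ω.2 (n + 1)).1 = true then 1 else 0))) := by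
  rw [ENNReal.tsum_add, totalCost]
  refine add_le_add (toENNReal_le_tsum _) (ENNReal.tsum_le_tsum fun n => ?_)
  split_ifs with h1 h2 h3 h4 h5
  · simpa using le_gMax g _ _
  · rw [action_succ m ω (by omega), nextAction, if_neg h3, hg]
    simp
  · exact absurd h1.2 h2
  · exact absurd h1.2 h2
  all_goals exact zero_le

open Classical in
theorem lintegral_ite_lt_stopTime (i : Fin M) (L : ℝ) (n : ℕ) :
    ∫⁻ ω, (if (n : ℕ∞) < stopTime ω m L then (1 : ℝ≥0∞) else 0) ∂law m lam ν η i =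
      law m lam ν η i {ω | (n : ℕ∞) < stopTime ω m L} := by
  rw [← lintegral_indicator_one (measurableSet_lt_stopTime m L n)]
  exact lintegral_congr fun ω => by simp [Set.indicator_apply]

-- The event {n < τ} depends on the variables up to time n only, so it is independent of U_{n+1}.
-- This is the source of the factor η in the switching cost.
open Classical in
theorem lintegral_lt_stopTime_mul_switch (i : Fin M) (L : ℝ) (n : ℕ) :
    ∫⁻ ω, (if (n : ℕ∞) < stopTime ω m L then (1 : ℝ≥0∞) else 0) *
        (if (ω.2 (n + 1)).1 = true then 1 else 0) ∂law m lam ν η i =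
      law m lam ν η i {ω | (n : ℕ∞) < stopTime ω m L} * ENNReal.ofReal η := by
  have hm1 : Measurable fun ω : Sample M A X =>
      if (n : ℕ∞) < stopTime ω m L then (1 : ℝ≥0∞) else 0 :=
    Measurable.ite (measurableSet_lt_stopTime m L n) measurable_const measurable_const
  have hm2 : Measurable fun s : Seed M A X => if s.1 = true then (1 : ℝ≥0∞) else 0 :=
    Measurable.ite (measurableSet_eq_fun measurable_fst measurable_const) measurable_const
      measurable_const
  refine (lintegral_of_resample_eq m lam ν η i (n + 1)
    (F := fun ω s => (if (n : ℕ∞) < stopTime ω m L then (1 : ℝ≥0∞) else 0) *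
      (if s.1 = true then 1 else 0)) (hm1.mul (hm2.comp (measurable_seed (n + 1))))
    fun ω s => by simp only [lt_stopTime_resample m ω L (Nat.lt_succ_self n)]).trans ?_
  simp only [lintegral_const_mul _ hm2, lintegral_seedLaw_switch]
  rw [lintegral_mul_const _ hm1, lintegral_ite_lt_stopTime]

open Classical in
theorem lintegral_totalCost_le (i : Fin M) (g : A → A → ℝ≥0) (hg : ∀ a, g a a = 0) (L : ℝ) :
    ∫⁻ ω, totalCost ω m g L ∂law m lam ν η i ≤
      (1 + gMax g * ENNReal.ofReal η) *
        ∑' n : ℕ, law m lam ν η i {ω | (n : ℕ∞) < stopTime ω m L} := by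
  have hm1 (n : ℕ) : Measurable fun ω : Sample M A X =>
      if (n : ℕ∞) < stopTime ω m L then (1 : ℝ≥0∞) else 0 :=
    Measurable.ite (measurableSet_lt_stopTime m L n) measurable_const measurable_const
  have hm2 (n : ℕ) : Measurable fun ω : Sample M A X =>
      (if (n : ℕ∞) < stopTime ω m L then (1 : ℝ≥0∞) else 0) *
        (if (ω.2 (n + 1)).1 = true then 1 else 0) :=
    (hm1 n).mul (Measurable.ite (measurableSet_eq_fun (measurable_fst.comp
      (measurable_seed (n + 1))) measurable_const) measurable_const measurable_const)
  refine (lintegral_mono fun ω => totalCost_le g hg L ω).trans ?_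
  have hm3 (n : ℕ) : Measurable fun ω : Sample M A X =>
      (if (n : ℕ∞) < stopTime ω m L then (1 : ℝ≥0∞) else 0) +
        gMax g * ((if (n : ℕ∞) < stopTime ω m L then (1 : ℝ≥0∞) else 0) *
          (if (ω.2 (n + 1)).1 = true then 1 else 0)) := (hm1 n).add ((hm2 n).const_mul _)
  rw [lintegral_tsum fun n => (hm3 n).aemeasurable,
    ← ENNReal.tsum_mul_left]
  refine ENNReal.tsum_le_tsum fun n => ?_
  rw [lintegral_add_left (hm1 n), lintegral_const_mul _ (hm2 n),
    lintegral_lt_stopTime_mul_switch, lintegral_ite_lt_stopTime]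
  exact le_of_eq (by ring)

-- If i leads every other hypothesis by more than b, which is at least the positive threshold, then
-- θ = i and the test retires.
omit [DiscreteMeasurableSpace A] in
theorem ae_exists_of_not_retires (i : Fin M) {L b : ℝ}
    (hb : 0 < Real.log (((M : ℝ) - 1) * L)) (n : ℕ) (h : Real.log (((M : ℝ) - 1) * L) ≤ b) :
    ∀ᵐ ω ∂law m lam ν η i, ¬ Retires ω m L n →
      ∃ j ∈ Finset.univ.erase i, Z ω m i n - Z ω m j n ≤ b := by
  filter_upwards [theta_mem_argmax lam ν η i] with ω hθ hr
  by_contra! hc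
  have hgap (j : Fin M) (hj : j ≠ i) : b < Z ω m i n - Z ω m j n :=
    hc j (Finset.mem_erase.2 ⟨hj, Finset.mem_univ j⟩)
  have hi : theta ω m n = i := by
    by_contra hne
    have h1 := hgap _ hne
    have h2 := hθ n i
    linarith
  refine hr fun j hj => ?_
  rw [hi] at hj ⊢
  exact h.trans (hgap j hj).le

/-- The expected stopping time is at most `log ((M - 1) L) / (D - ε) + O(1)`. -/
theorem exists_tsum_measure_lt_stopTime_le (hI : m.AssumptionI) (hIIb : 0 < m.beta lam)
    (hη : (0 : ℝ) < η) (i : Fin M) {D ε : ℝ}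
    (hD : ∀ j, j ≠ i → D ≤ ∑ b, (lam i b).toReal * (m.relEnt i j b).toReal) (hε : 0 < ε)
    (hεD : ε < D) :
    ∃ U : ℝ, 0 ≤ U ∧ ∀ L : ℝ, 0 < Real.log (((M : ℝ) - 1) * L) →
      ∑' n : ℕ, law m lam ν η i {ω | (n : ℕ∞) < stopTime ω m L} ≤
        ENNReal.ofReal (Real.log (((M : ℝ) - 1) * L) / (D - ε) + U) := by
  have htail (j : Fin M) : ∃ C r : ℝ, 0 ≤ C ∧ 0 ≤ r ∧ r < 1 ∧ (j ≠ i → ∀ n : ℕ, law m lam ν η i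
      {ω | Z ω m i (n + 1) - Z ω m j (n + 1) ≤ (n + 1) * (D - ε)} ≤
        ENNReal.ofReal (C * r ^ n)) := by
    by_cases hj : j = i
    · exact ⟨0, 0, le_rfl, le_rfl, one_pos, fun h => absurd hj h⟩
    · obtain ⟨C, r, h1, h2, h3, h4⟩ := measure_logRatio_le lam ν η hI hIIb hη i j (hD j hj) hε
      exact ⟨C, r, h1, h2, h3, fun _ => h4⟩
  choose C r hC hr0 hr1 htail using htail
  let u (n : ℕ) : ℝ := ∑ j ∈ Finset.univ.erase i, C j * r j ^ n
  have hu0 (n : ℕ) : 0 ≤ u n :=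
    Finset.sum_nonneg fun j _ => mul_nonneg (hC j) (pow_nonneg (hr0 j) n)
  have hus : Summable u :=
    summable_sum fun j _ => (summable_geometric_of_lt_one (hr0 j) (hr1 j)).mul_left (C j)
  -- The 2 pays for the term n = 0 and for rounding N up; u is the union bound for the later terms,
  -- and it does not depend on L.
  refine ⟨2 + ∑' n, u n, add_nonneg zero_le_two (tsum_nonneg hu0), fun L hL => ?_⟩
  have hDε : 0 < D - ε := sub_pos.2 hεD
  set ℓ := Real.log (((M : ℝ) - 1) * L) with hℓ
  set N := ⌈ℓ / (D - ε)⌉₊ with hN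
  have hstep (n : ℕ) : law m lam ν η i {ω | ((n + 1 : ℕ) : ℕ∞) < stopTime ω m L} ≤
      (if n < N then 1 else 0) + ENNReal.ofReal (u n) := by
    by_cases hn : n < N
    · rw [if_pos hn]
      exact le_add_right prob_le_one
    · rw [if_neg hn, zero_add]
      have hb : ℓ ≤ (n + 1) * (D - ε) := by
        have h1 : ℓ / (D - ε) ≤ n := (Nat.le_ceil _).trans (by exact_mod_cast not_lt.1 hn)
        rw [div_le_iff₀ hDε] at h1
        linarith
      have hsub : ({ω | ((n + 1 : ℕ) : ℕ∞) < stopTime ω m L} : Set (Sample M A X))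
          ≤ᵐ[law m lam ν η i] ⋃ j ∈ Finset.univ.erase i,
            {ω | Z ω m i (n + 1) - Z ω m j (n + 1) ≤ (n + 1) * (D - ε)} := by
        filter_upwards [ae_exists_of_not_retires lam ν η i hL (n + 1) hb] with ω h hω
        obtain ⟨j, hj, hj'⟩ := h ((lt_stopTime_iff m).1 hω (n + 1)
          (Finset.mem_Icc.2 ⟨by omega, le_rfl⟩))
        exact Set.mem_biUnion hj hj'
      refine (measure_mono_ae hsub).trans ((measure_biUnion_finset_le _ _).trans ?_)
      rw [ENNReal.ofReal_sum_of_nonneg fun j _ => mul_nonneg (hC j) (pow_nonneg (hr0 j) n)]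
      exact Finset.sum_le_sum fun j hj => htail j (Finset.ne_of_mem_erase hj) n
  have hcount : ∑' n : ℕ, (if n < N then (1 : ℝ≥0∞) else 0) = N := by
    rw [tsum_eq_sum (s := Finset.range N) fun n hn => if_neg (by simpa using hn),
      Finset.sum_congr rfl fun n hn => if_pos (Finset.mem_range.1 hn)]
    simp
  rw [tsum_eq_zero_add' ENNReal.summable]
  calc _ ≤ 1 + ∑' n : ℕ, ((if n < N then 1 else 0) + ENNReal.ofReal (u n)) :=
        add_le_add prob_le_one (ENNReal.tsum_le_tsum hstep)
    _ = 1 + (N + ENNReal.ofReal (∑' n, u n)) := by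
        rw [ENNReal.tsum_add, hcount, ENNReal.ofReal_tsum_of_nonneg hu0 hus]
    _ = ENNReal.ofReal (1 + (N + ∑' n, u n)) := by
        rw [ENNReal.ofReal_add zero_le_one (add_nonneg N.cast_nonneg (tsum_nonneg hu0)),
          ENNReal.ofReal_add N.cast_nonneg (tsum_nonneg hu0), ENNReal.ofReal_one,
          ENNReal.ofReal_natCast]
    _ ≤ _ := by
        refine ENNReal.ofReal_le_ofReal ?_
        have := (Nat.ceil_lt_add_one (div_nonneg hL.le hDε.le)).le
        linarith

theorem limsup_lintegral_totalCost_le (hM : 2 ≤ M) (hI : m.AssumptionI) (hIIb : 0 < m.beta lam)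
    (hη : (0 : ℝ) < η) (i : Fin M) {D ε : ℝ}
    (hD : ∀ j, j ≠ i → D ≤ ∑ b, (lam i b).toReal * (m.relEnt i j b).toReal) (hε : 0 < ε)
    (hεD : ε < D) (g : A → A → ℝ≥0) (hg : ∀ a, g a a = 0) :
    limsup (fun L : ℝ =>
        ∫⁻ ω, totalCost ω m g L / ENNReal.ofReal (Real.log L) ∂law m lam ν η i) atTop ≤
      (1 + gMax g * ENNReal.ofReal η) * ENNReal.ofReal (1 / (D - ε)) := by
  obtain ⟨U, hU0, hU⟩ := exists_tsum_measure_lt_stopTime_le lam ν η hI hIIb hη i hD hε hεD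
  have hDε : 0 < D - ε := sub_pos.2 hεD
  have hM1 : (1 : ℝ) ≤ (M : ℝ) - 1 := by
    have : (2 : ℝ) ≤ M := by exact_mod_cast hM
    linarith
  set a := Real.log ((M : ℝ) - 1) with ha
  have ha0 : 0 ≤ a := Real.log_nonneg hM1
  have hc : (1 + gMax g * ENNReal.ofReal η : ℝ≥0∞) ≠ ⊤ := by finiteness
  have hle : ∀ᶠ L : ℝ in atTop,
      ∫⁻ ω, totalCost ω m g L / ENNReal.ofReal (Real.log L) ∂law m lam ν η i ≤
        (1 + gMax g * ENNReal.ofReal η) *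
          ENNReal.ofReal (1 / (D - ε) + (a / (D - ε) + U) * (Real.log L)⁻¹) := by
    filter_upwards [eventually_gt_atTop 1] with L hL
    have hlog : 0 < Real.log L := Real.log_pos hL
    have hmul : Real.log (((M : ℝ) - 1) * L) = a + Real.log L :=
      Real.log_mul (by linarith) (by linarith)
    have h1 := hU L (by rw [hmul]; linarith)
    simp only [div_eq_mul_inv _ (ENNReal.ofReal _)]
    -- Since log L > 0, its inverse is finite and leaves the integral without any measurability of
    -- the total cost.
    rw [lintegral_mul_const' _ _ (ENNReal.inv_ne_top.2 (by simpa using hlog))]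
    calc _ ≤ (1 + gMax g * ENNReal.ofReal η) * ENNReal.ofReal ((a + Real.log L) / (D - ε) + U) *
          (ENNReal.ofReal (Real.log L))⁻¹ := by
          refine mul_le_mul_left ((lintegral_totalCost_le lam ν η i g hg L).trans ?_) _
          rw [← hmul]
          exact mul_le_mul_right h1 _
      _ = _ := by
          rw [mul_assoc, ← ENNReal.ofReal_inv_of_pos hlog, ← ENNReal.ofReal_mul (by positivity)]
          congr 2
          field_simp
          ring
  have hlim : Tendsto (fun L : ℝ => (1 + gMax g * ENNReal.ofReal η) *
      ENNReal.ofReal (1 / (D - ε) + (a / (D - ε) + U) * (Real.log L)⁻¹)) atTop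
      (nhds ((1 + gMax g * ENNReal.ofReal η) * ENNReal.ofReal (1 / (D - ε)))) := by
    refine ENNReal.Tendsto.const_mul (ENNReal.tendsto_ofReal ?_) (Or.inr hc)
    have := ((Real.tendsto_log_atTop.inv_tendsto_atTop).const_mul (a / (D - ε) + U)).const_add
      (1 / (D - ε))
    simpa using this
  exact (limsup_le_limsup hle).trans_eq hlim.limsup_eq

end Cost

end ASHT

end

theorem mainTheorem3 {M : ℕ} [NeZero M] (hM : 2 ≤ M)
    {A X : Type*} [Fintype A] [MeasurableSpace A] [DiscreteMeasurableSpace A] [MeasurableSpace X]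
    (m : ASHT.Model M A X)
    (lam : Fin M → PMF A) (hlam : ∀ k, IsMaxOn (m.guard k) Set.univ (lam k))
    (hI : m.AssumptionI) (hIIb : 0 < m.beta lam)
    (g : A → A → ℝ≥0) (hg : ∀ a, g a a = 0)
    (ν : PMF A) (η : ℝ) (hη0 : 0 < η) (hη1 : η ≤ 1) (i : Fin M) :
    limsup
      (fun L : ℝ =>
        ∫⁻ ω, ASHT.totalCost ω m g L / ENNReal.ofReal (Real.log L)
          ∂(ASHT.law m lam ν ⟨η, hη0.le, hη1⟩ i))
      atTop
      ≤ 1 / m.D i + ((ASHT.gMax g : ℝ≥0∞) * ENNReal.ofReal η) / m.D i := by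
  have htop := ASHT.D_ne_top hM hI hlam i
  have hpos : 0 < (m.D i).toReal := ENNReal.toReal_pos (ASHT.D_pos hIIb hlam i).ne' htop
  have hlim : Tendsto (fun ε : ℝ => (1 + (ASHT.gMax g : ℝ≥0∞) * ENNReal.ofReal η) *
      ENNReal.ofReal (1 / ((m.D i).toReal - ε))) (nhdsWithin 0 (Set.Ioi 0))
      (nhds ((1 + (ASHT.gMax g : ℝ≥0∞) * ENNReal.ofReal η) *
        ENNReal.ofReal (1 / ((m.D i).toReal - 0)))) := by
    refine ENNReal.Tendsto.const_mul (ENNReal.tendsto_ofReal ?_) (Or.inr (by finiteness))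
    refine Tendsto.mono_left ?_ nhdsWithin_le_nhds
    exact tendsto_const_nhds.div (tendsto_const_nhds.sub tendsto_id) (by simpa using hpos.ne')
  have hval : (1 + (ASHT.gMax g : ℝ≥0∞) * ENNReal.ofReal η) *
      ENNReal.ofReal (1 / ((m.D i).toReal - 0)) =
      1 / m.D i + ((ASHT.gMax g : ℝ≥0∞) * ENNReal.ofReal η) / m.D i := by
    rw [sub_zero, one_div, ENNReal.ofReal_inv_of_pos hpos, ENNReal.ofReal_toReal htop,
      ← div_eq_mul_inv, ENNReal.add_div]
  rw [← hval]
  -- The left-hand side does not involve ε, so the bounds for 0 < ε < D_i pass to the limit.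
  refine ge_of_tendsto hlim ?_
  filter_upwards [self_mem_nhdsWithin, nhdsWithin_le_nhds (gt_mem_nhds hpos)] with ε hε hεD
  exact ASHT.limsup_lintegral_totalCost_le lam ν ⟨η, hη0.le, hη1⟩ hM hI hIIb hη0 i
    (fun j hj => ASHT.toReal_D_le_sum hI hlam hj) hε hεD g hg
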